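/- Let $\Delta=\{x\in\mathbb R^m : L_j(x)=\langle u_j,x\rangle+c_j\ge 0,\ j=1,\dots,d\}$ be a compact convex simple polytope with non-empty interior $\Delta^0$, none of the $d$ inequalities being redundant, labelled by $\mathbf L=(L_1,\dots,L_d)$ (simple: at each vertex exactly $m$ of the $L_j$ vanish and the corresponding normals $u_j$ form a basis of $\mathbb R^m$). Let $dv$ be Lebesgue measure, and let $d\sigma$ be the measure on $\partial\Delta$ with $dL_j\wedge d\sigma=-dv$ on the facet $F_j=\Delta\cap\{L_j=0\}$, i.e. surface measure divided by $|u_j|$. Let $s_{(\Delta,\mathbf L)}$ be the unique affine-linear function with $2\int_{\partial\Delta}g\,d\sigma-\int_\Delta s_{(\Delta,\mathbf L)}\,g\,dv=0$ for all affine-linear $g$, and put, for $f\in C^0(\Delta)$, $$\mathcal F_{(\Delta,\mathbf L)}(f)=2\int_{\partial\Delta}f\,d\sigma-\int_\Delta s_{(\Delta,\mathbf L)}f\,dv .$$ Let $\mathcal C(\Delta)$ be the set of continuous convex functions on $\Delta$ and $\mathcal C_\infty(\Delta)$ the subset of those that are smooth on $\Delta^0$. Put $u_0=\frac12\sum_j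 L_j\log L_j$ and $G_0=\mathrm{Hess}\,u_0$. Let $\mathcal S(\Delta,\mathbf L)$ be the set of symplectic potentials: the $u\in\mathcal C_\infty(\Delta)$ whose Hessian $G$ is positive definite on $\Delta^0$ and for which $G-G_0$ is smooth on $\Delta$ and $G_0^{-1}G$ is smooth and nondegenerate on $\Delta$. For $u\in\mathcal S(\Delta,\mathbf L)$ put $$\mathcal E_{(\Delta,\mathbf L)}(u)=\mathcal F_{(\Delta,\mathbf L)}(u)-\int_\Delta\big(\log\det\mathrm{Hess}\,u-\log\det\mathrm{Hess}\,u_0\big)\,dv .$$ Let $\mathcal C^*(\Delta)\subset\mathcal C(\Delta)$ be a slice for the translation action of the affine-linear functions, closed under positive linear combinations: each $f\in\mathcal C(\Delta)$ can be written as $f=\pi(f)+g$ with $\pi(f)\in\mathcal C^*(\Delta)$ and $g$ affine-linear, and $\pi(f)$ is unique if $f\in\mathcal C_\infty(\Delta)$. (If $\pi(f)$ is not unique for some other $f$, statements about $\pi(f)$ are meant for every choice of it.) Suppose that normalization is compatible with uniform convergence in the following sense: for each $h\in\mathcal C^*(\Delta)$ and $\varepsilon>0$ there is a non-empty subset $U\subset\mathcal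 C(\Delta)$, open in $\mathcal C(\Delta)$ for uniform convergence, such that $\|\pi(f)-h\|_\infty<\varepsilon$ for all $f\in U$. (This holds if $\pi$ is single-valued and continuous, for example for the slice of all $f\in\mathcal C(\Delta)$ that are $L^2$-orthogonal to the affine-linear functions; it also holds for $\{f\in\mathcal C(\Delta):f\ge f(x_0)=0\}$ with $x_0\in\Delta^0$.) Let $\|\cdot\|$ be a tamed seminorm: a seminorm on $C^0(\Delta)$ for which there is $C>0$ with $\frac1C\int_\Delta|h|\,dv\le\|h\|$ for all $h\in\mathcal C^*(\Delta)$ and $\|f\|\le C\|f\|_\infty$ for all $f\in C^0(\Delta)$. (So it does not vanish on any non-zero element of $\mathcal C^*(\Delta)$.) Then for any $\lambda>0$ the following are equivalent: (i) $\mathcal F_{(\Delta,\mathbf L)}(f)\ge\lambda\|\pi(f)\|$ for all $f\in\mathcal C(\Delta)$; (ii) for all $0\le\delta<\lambda$ there exists $C_\delta\in\mathbb R$ such that $\mathcal E_{(\Delta,\mathbf L)}(u)\ge\delta\|\pi(u)\|+C_\delta$ for all $u\in\mathcal S(\Delta,\mathbf L)$. -/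

import Mathlib

open MeasureTheory Set
open scoped ContDiff

noncomputable section

namespace UniformKStability

/-- Euclidean space `ℝ^m`. -/
abbrev E (m : ℕ) : Type := EuclideanSpace ℝ (Fin m)

/-- The affine-linear function `x ↦ ⟨u, x⟩ + c`. -/
def affineLabel {m : ℕ} (u : E m) (c : ℝ) (x : E m) : ℝ := inner ℝ u x + c

/-- The polyhedron cut out by the inequalities `⟨u_j, x⟩ + c_j ≥ 0`. -/
def polyhedron {m d : ℕ} (u : Fin d → E m) (c : Fin d → ℝ) : Set (E m) :=
  {x | ∀ j, 0 ≤ affineLabel (u j) (c j) x}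

/-- A labelled compact convex simple polytope `(Δ, L)` in `ℝ^m`: the polytope
`Δ = {x | L_j(x) ≥ 0, j = 1, …, d}` is full-dimensional and compact, none of the `d` inequalities
`L_j(x) = ⟨u_j, x⟩ + c_j ≥ 0` can be dropped, and at each vertex exactly `m` of the `L_j` vanish and
the corresponding normals `u_j` form a basis. -/
structure LabelledPolytope (m : ℕ) where
  /-- the number of labels -/
  d : ℕ
  /-- the normals -/
  normal : Fin d → E m
  /-- the constant terms of the labels -/
  const : Fin d → ℝ
  isCompact : IsCompact (polyhedron normal const)
  interior_nonempty : (interior (polyhedron normal const)).Nonempty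
  minimal : ∀ j, ∃ x, (∀ i, i ≠ j → 0 ≤ affineLabel (normal i) (const i) x) ∧
    affineLabel (normal j) (const j) x < 0
  card_vertex : ∀ x ∈ extremePoints ℝ (polyhedron normal const),
    Nat.card {j // affineLabel (normal j) (const j) x = 0} = m
  linearIndependent_vertex : ∀ x ∈ extremePoints ℝ (polyhedron normal const),
    LinearIndependent ℝ (fun j : {j // affineLabel (normal j) (const j) x = 0} => normal j)

namespace LabelledPolytope

variable {m : ℕ} (P : LabelledPolytope m)

/-- The label `L_j`. -/
def L (j : Fin P.d) (x : E m) : ℝ := affineLabel (P.normal j) (P.const j) x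

/-- The polytope `Δ`. -/
def Δ : Set (E m) := polyhedron P.normal P.const

/-- The facet `F_j = Δ ∩ {L_j = 0}`. -/
def facet (j : Fin P.d) : Set (E m) := {x | x ∈ P.Δ ∧ P.L j x = 0}

instance compactSpace : CompactSpace P.Δ := isCompact_iff_compactSpace.mp P.isCompact

/-- A continuous function on `Δ`, extended by zero to `ℝ^m`. -/
def ext (f : C(P.Δ, ℝ)) : E m → ℝ := Function.extend Subtype.val f 0

/-- The measure `dσ` on `∂Δ`: on the facet `F_j` it is determined by `dL_j ∧ dσ = -dv`, so it is the
`(m-1)`-dimensional Euclidean surface measure divided by `|dL_j| = |u_j|`. -/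
def σ : Measure (E m) :=
  Measure.sum fun j : Fin P.d =>
    ENNReal.ofReal ‖P.normal j‖⁻¹ •
      (Measure.euclideanHausdorffMeasure (m - 1) : Measure (E m)).restrict (P.facet j)

/-! ### The extremal affine-linear function -/

theorem normal_ne_zero (j : Fin P.d) : P.normal j ≠ 0 := by
  intro h
  obtain ⟨x, -, hx⟩ := P.minimal j
  obtain ⟨y, hy⟩ := P.interior_nonempty
  have := interior_subset hy j
  simp [affineLabel, h] at hx this
  linarith

theorem continuous_L (j : Fin P.d) : Continuous (P.L j) := by
  unfold L affineLabel
  fun_prop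

theorem isCompact_facet (j : Fin P.d) : IsCompact (P.facet j) := by
  have : P.facet j = P.Δ ∩ P.L j ⁻¹' {0} := rfl
  rw [this]
  exact IsCompact.inter_right P.isCompact (isClosed_singleton.preimage (P.continuous_L j))

theorem hausdorff_facet_lt_top (j : Fin P.d) :
    (Measure.euclideanHausdorffMeasure (m - 1) : Measure (E m)) (P.facet j) < ⊤ := by
  set u := P.normal j with hu
  have hu0 : u ≠ 0 := P.normal_ne_zero j
  rcases (P.facet j).eq_empty_or_nonempty with h | ⟨p, hp⟩
  · simp [h]
  let φ : (ℝ ∙ u)ᗮ → E m := fun v => (v : E m) + p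
  have hφ : Isometry φ := Isometry.of_dist_eq fun a b => by
    simp only [φ, dist_add_right]
    rfl
  have hsub : P.facet j ⊆ range φ := by
    intro x hx
    refine ⟨⟨x - p, ?_⟩, by simp [φ]⟩
    rw [Submodule.mem_orthogonal_singleton_iff_inner_right, inner_sub_right]
    have h1 := hx.2
    have h2 := hp.2
    simp only [L, affineLabel] at h1 h2
    linarith
  have hrank : Module.finrank ℝ (ℝ ∙ u)ᗮ = m - 1 := by
    have := (ℝ ∙ u).finrank_add_finrank_orthogonal
    rw [finrank_span_singleton hu0, finrank_euclideanSpace_fin] at this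
    omega
  have hc : IsCompact (φ ⁻¹' P.facet j) :=
    hφ.isClosedEmbedding.isCompact_preimage (P.isCompact_facet j)
  have h := hφ.euclideanHausdorffMeasure_preimage (d := m - 1) (P.facet j)
  rw [inter_eq_left.mpr hsub] at h
  rw [← h, ← hrank, InnerProductSpace.euclideanHausdorffMeasure_eq_volume]
  exact hc.measure_lt_top

instance isFiniteMeasure_σ : IsFiniteMeasure P.σ := by
  constructor
  rw [σ, Measure.sum_apply _ MeasurableSet.univ, tsum_fintype]
  refine ENNReal.sum_lt_top.mpr fun j _ => ?_
  simp only [Measure.smul_apply, Measure.restrict_apply MeasurableSet.univ, univ_inter,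
    smul_eq_mul]
  exact ENNReal.mul_lt_top ENNReal.ofReal_lt_top (P.hausdorff_facet_lt_top j)

theorem ae_mem_Δ : ∀ᵐ x ∂P.σ, x ∈ P.Δ := by
  have hm : MeasurableSet {x | x ∈ P.Δ} := P.isCompact.measurableSet
  rw [σ, Measure.ae_sum_iff' hm]
  intro j
  refine Measure.ae_smul_measure ?_ _
  exact (ae_restrict_mem (P.isCompact_facet j).measurableSet).mono fun x hx => hx.1

theorem integrable_σ (f : E m →ᵃ[ℝ] ℝ) : Integrable f P.σ := by
  have hf : Continuous f := f.continuous_of_finiteDimensional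
  obtain ⟨M, hM⟩ := P.isCompact.exists_bound_of_continuousOn hf.continuousOn
  exact Integrable.of_bound hf.aestronglyMeasurable M (P.ae_mem_Δ.mono fun x hx => hM x hx)

theorem integrableOn_mul (s f : E m →ᵃ[ℝ] ℝ) : IntegrableOn (fun x => s x * f x) P.Δ :=
  (s.continuous_of_finiteDimensional.mul f.continuous_of_finiteDimensional).continuousOn
    |>.integrableOn_compact P.isCompact

/-- The pairing `(s, f) ↦ ∫_Δ s f dv` on affine-linear functions. -/
def pairing : (E m →ᵃ[ℝ] ℝ) →ₗ[ℝ] Module.Dual ℝ (E m →ᵃ[ℝ] ℝ) :=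
  LinearMap.mk₂ ℝ (fun s f => ∫ x in P.Δ, s x * f x)
    (fun a b f => by
      rw [← integral_add (P.integrableOn_mul a f) (P.integrableOn_mul b f)]
      simp [add_mul])
    (fun r a f => by simp [mul_assoc, integral_const_mul])
    (fun a f g => by
      rw [← integral_add (P.integrableOn_mul a f) (P.integrableOn_mul a g)]
      simp [mul_add])
    (fun r a f => by simp [mul_left_comm, integral_const_mul])

theorem pairing_injective : Function.Injective P.pairing := by
  rw [← LinearMap.ker_eq_bot, LinearMap.ker_eq_bot']
  intro s hs
  have h0 : ∫ x in P.Δ, s x * s x = 0 := by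
    have := congrArg (fun l => l s) hs
    simpa [pairing] using this
  have hc : Continuous s := s.continuous_of_finiteDimensional
  have hint : IntegrableOn (fun x => s x * s x) (interior P.Δ) :=
    (P.integrableOn_mul s s).mono_set interior_subset
  have h1 : ∫ x in interior P.Δ, s x * s x = 0 := by
    refine le_antisymm ?_ (integral_nonneg fun x => mul_self_nonneg _)
    rw [← h0]
    exact setIntegral_mono_set (P.integrableOn_mul s s)
      (Filter.Eventually.of_forall fun x => mul_self_nonneg _)
      (Filter.Eventually.of_forall interior_subset)
  have h2 := (integral_eq_zero_iff_of_nonneg (fun x => mul_self_nonneg (s x)) hint).mp h1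
  have h3 : EqOn (fun x => s x * s x) 0 (interior P.Δ) :=
    Measure.eqOn_open_of_ae_eq h2 isOpen_interior (hc.mul hc).continuousOn continuousOn_const
  have h4 : EqOn s (0 : E m →ᵃ[ℝ] ℝ) (interior P.Δ) := fun x hx => by
    simpa using h3 hx
  refine AffineMap.ext_on ?_ h4
  exact isOpen_interior.affineSpan_eq_top P.interior_nonempty

/-- There is exactly one affine-linear function `s` such that
`2 ∫_{∂Δ} f dσ - ∫_Δ s f dv = 0` for all affine-linear `f`. -/
theorem existsUnique_extremal : ∃! s : E m →ᵃ[ℝ] ℝ, ∀ f : E m →ᵃ[ℝ] ℝ,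
    2 * ∫ x, f x ∂P.σ - ∫ x in P.Δ, s x * f x = 0 := by
  let ℓ : Module.Dual ℝ (E m →ᵃ[ℝ] ℝ) :=
    { toFun := fun f => 2 * ∫ x, f x ∂P.σ
      map_add' := fun f g => by
        have := integral_add (P.integrable_σ f) (P.integrable_σ g)
        simp only [AffineMap.coe_add, Pi.add_apply]
        rw [this, mul_add]
      map_smul' := fun r f => by
        simp only [AffineMap.coe_smul, Pi.smul_apply, smul_eq_mul, integral_const_mul,
          RingHom.id_apply]
        ring }
  have hsurj : Function.Surjective P.pairing :=
    (LinearMap.injective_iff_surjective_of_finrank_eq_finrank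
      (Subspace.dual_finrank_eq).symm).mp P.pairing_injective
  obtain ⟨s, hs⟩ := hsurj ℓ
  have key : ∀ t : E m →ᵃ[ℝ] ℝ, P.pairing t = ℓ ↔ ∀ f : E m →ᵃ[ℝ] ℝ,
      2 * ∫ x, f x ∂P.σ - ∫ x in P.Δ, t x * f x = 0 := by
    intro t
    rw [LinearMap.ext_iff]
    refine forall_congr' fun f => ?_
    rw [sub_eq_zero, eq_comm]
    rfl
  refine ⟨s, (key s).mp hs, fun t ht => P.pairing_injective ?_⟩
  rw [(key t).mpr ht, hs]

/-- The extremal affine-linear function `s_{(Δ, L)}`. -/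
def extremal : E m →ᵃ[ℝ] ℝ := P.existsUnique_extremal.choose

/-! ### Function spaces and functionals -/

/-- The Donaldson–Futaki invariant
`𝓕(f) = 2 ∫_{∂Δ} f dσ - ∫_Δ s_{(Δ, L)} f dv` on continuous functions. -/
def futaki (f : C(P.Δ, ℝ)) : ℝ :=
  2 * ∫ x, P.ext f x ∂P.σ - ∫ x in P.Δ, P.extremal x * P.ext f x

/-- `𝓒(Δ)`: the continuous convex functions on `Δ`. -/
def convexFun : Set C(P.Δ, ℝ) := {f | ConvexOn ℝ P.Δ (P.ext f)}

/-- `𝓒_∞(Δ)`: the continuous convex functions on `Δ` that are smooth on the interior. -/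
def convexSmooth : Set C(P.Δ, ℝ) :=
  {f | f ∈ P.convexFun ∧ ContDiffOn ℝ ∞ (P.ext f) (interior P.Δ)}

/-- The (restrictions to `Δ` of) affine-linear functions. -/
def IsAffine (g : C(P.Δ, ℝ)) : Prop := ∃ a : E m →ᵃ[ℝ] ℝ, ∀ x : P.Δ, g x = a x

/-- The Hessian matrix of `f` at `x`. -/
def hess (f : E m → ℝ) (x : E m) : Matrix (Fin m) (Fin m) ℝ :=
  Matrix.of fun i j =>
    fderiv ℝ (fderiv ℝ f) x (EuclideanSpace.single i 1) (EuclideanSpace.single j 1)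

/-- Guillemin's canonical potential `u₀ = (1/2) ∑ L_j log L_j`. -/
def canonical (x : E m) : ℝ := (1 / 2) * ∑ j, P.L j x * Real.log (P.L j x)

/-- A matrix-valued function on the interior of `Δ` is smooth on `Δ` if it is the restriction of a
smooth function `N` on `ℝ^m`. -/
def IsSmoothExtension (A N : E m → Matrix (Fin m) (Fin m) ℝ) : Prop :=
  (∀ i j, ContDiff ℝ ∞ fun x => N x i j) ∧ ∀ x ∈ interior P.Δ, N x = A x

/-- `𝓢(Δ, L)`: the symplectic potentials. These are the continuous convex functions on `Δ`, smooth
with positive definite Hessian `G` on the interior, such that `G - G₀` is smooth on `Δ` and `G₀⁻¹ G`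
is smooth and nondegenerate on `Δ`, where `G₀` is the Hessian of `u₀`. -/
def symplecticPotentials : Set C(P.Δ, ℝ) :=
  {u | u ∈ P.convexSmooth ∧
    (∀ x ∈ interior P.Δ, (hess (P.ext u) x).PosDef) ∧
    (∃ N, P.IsSmoothExtension (fun x => hess (P.ext u) x - hess P.canonical x) N) ∧
    ∃ N, P.IsSmoothExtension (fun x => (hess P.canonical x)⁻¹ * hess (P.ext u) x) N ∧
      ∀ x ∈ P.Δ, IsUnit (N x).det}

/-- The relative K-energy
`𝓔(u) = 𝓕(u) - ∫_Δ (log det Hess u - log det Hess u₀) dv`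
(the boundary of `Δ` is a null set). -/
def kEnergy (u : C(P.Δ, ℝ)) : ℝ :=
  P.futaki u - ∫ x in interior P.Δ,
    (Real.log (hess (P.ext u) x).det - Real.log (hess P.canonical x).det)

/-- `h` is a normalization `π(f)` of `f` with respect to `S`: `h ∈ S` and `f - h` is affine-linear. -/
def IsNormalization (S : Set C(P.Δ, ℝ)) (f h : C(P.Δ, ℝ)) : Prop := h ∈ S ∧ P.IsAffine (f - h)

/-- `S = 𝓒*(Δ)` is a slice for the translation action of the affine-linear functions on `𝓒(Δ)`,
closed under positive linear combinations. Each `f ∈ 𝓒(Δ)` is `π(f) + g` with `π(f) ∈ S` and `g`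
affine-linear. Uniqueness of this decomposition is required on `𝓒_∞(Δ)` only, so that
`{f | f ≥ f(x₀) = 0}` is included, where a function that is not differentiable at `x₀` has several
normalizations. -/
structure IsSlice (S : Set C(P.Δ, ℝ)) : Prop where
  subset : S ⊆ P.convexFun
  combination : ∀ f ∈ S, ∀ g ∈ S, ∀ a b : ℝ, 0 < a → 0 < b → a • f + b • g ∈ S
  exists_normalization : ∀ f ∈ P.convexFun, ∃ h, P.IsNormalization S f h
  unique_normalization : ∀ f ∈ P.convexSmooth, ∀ h h',
    P.IsNormalization S f h → P.IsNormalization S f h' → h = h'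

/-- The normalization is compatible with uniform convergence: arbitrarily close to each `h ∈ S` lie
all the normalizations of all functions of some non-empty open subset of `𝓒(Δ)`. If normalizations
are unique and `π` is continuous, the neighbourhoods of `h` itself do. -/
def IsStable (S : Set C(P.Δ, ℝ)) : Prop :=
  ∀ h ∈ S, ∀ ε > 0, ∃ f₀ ∈ P.convexFun, ∃ r > 0, ∀ f ∈ P.convexFun, ‖f - f₀‖ < r →
    ∀ h', P.IsNormalization S f h' → ‖h' - h‖ < ε

/-- The seminorm `p` is tamed: `C⁻¹ ‖h‖₁ ≤ p h` for normalized `h`, and `p f ≤ C ‖f‖_∞`.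
In particular `p` vanishes on no non-zero normalized function. -/
def IsTamed (S : Set C(P.Δ, ℝ)) (p : Seminorm ℝ C(P.Δ, ℝ)) : Prop :=
  ∃ C : ℝ, 0 < C ∧ (∀ h ∈ S, C⁻¹ * ∫ x in P.Δ, |P.ext h x| ≤ p h) ∧ ∀ f, p f ≤ C * ‖f‖

end LabelledPolytope

end UniformKStability

end

/-!
Let `u₀` be the canonical potential and `G₀` its Hessian.

*From coercivity of the energy to the bound on the invariant.* For `f` smooth and convex on `ℝ^m`
the ray `u₀ + k f` consists of symplectic potentials. The entropy term is nonpositive along it,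
because `log det` is increasing on positive matrices, so `𝓔(u₀ + k f) ≤ 𝓕(u₀) + k 𝓕(f)`; dividing by
`k → ∞` and then letting `δ → λ` gives the bound for `f`
(`mul_seminorm_le_futaki_of_contDiff`). Such `f` are dense in `𝓒(Δ)`
(`exists_contDiff_convex_near`), and stability of the normalization under uniform convergence carries
the bound over to all of `𝓒(Δ)`. That the ray consists of symplectic
potentials amounts to `G₀⁻¹` being smooth up to the boundary. This is where simplicity of the
polytope enters: `G₀⁻¹` is, up to a factor, a block of the inverse of a matrix with affine-linear
entries which is invertible on all of `Δ` exactly because the normals of the labels vanishing at a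
point are linearly independent (`det_blockMatrix_ne_zero`, `inv_hess_canonical`).

*From the bound on the invariant to coercivity.* It is enough to absorb the entropy into a small
multiple `θ` of `𝓕(u)` and `‖π(u)‖`. Put `φ = ∏ L_j`. The arithmetic-geometric inequality gives
`log det G ≤ θ φ tr G - m log (θ φ) - m`, where `log φ` is integrable, since the set where a label
is below `ε` has volume `O(ε)`, and `log det G₀` is bounded below
(`exists_integral_log_det_le`). There remains the estimate `∫_Δ φ tr (Hess v) dv ≤ K ∫_{∂Δ} v dσ`
for nonnegative convex `v` (`exists_lintegral_trace_hess_le`). It is one-dimensional: on each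
coordinate line `φ` is at most a multiple of a parabola vanishing at the endpoints, two integrations
by parts leave only endpoint values, and projecting facets along a coordinate axis does not increase
area. It is applied to `π(u)` plus a constant; the constant needed is at most a multiple of
`∫_Δ |π(u)| dv`, because convex functions are bounded below in terms of their `L^1` norm
(`exists_neg_mul_integral_abs_le`).
-/

noncomputable section

namespace UniformKStability

/-! ### Determinants of positive matrices -/

section Matrices

open Matrix

variable {n : Type*} [Fintype n] [DecidableEq n]

theorem one_le_det_one_add {S : Matrix n n ℝ} (hS : S.PosSemidef) : 1 ≤ (1 + S).det := by
  have hT : (1 + S).PosSemidef := PosSemidef.one.add hS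
  rw [hT.1.det_eq_prod_eigenvalues]
  have key : ∀ i, (1 : ℝ) ≤ hT.1.eigenvalues i := by
    intro i
    have h1 := hT.1.mulVec_eigenvectorBasis i
    set v : n → ℝ := ⇑(hT.1.eigenvectorBasis i) with hv
    have hv0 : v ⬝ᵥ v = 1 := by
      have h2 := hT.1.eigenvectorBasis.orthonormal.1 i
      rw [EuclideanSpace.norm_eq, Real.sqrt_eq_one] at h2
      rw [← h2]
      simp [dotProduct, hv, sq]
    have h3 := hS.dotProduct_mulVec_nonneg v
    have h4 : v ⬝ᵥ ((1 + S) *ᵥ v) = hT.1.eigenvalues i := by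
      rw [h1, dotProduct_smul, hv0]; simp
    rw [add_mulVec, one_mulVec, dotProduct_add, hv0] at h4
    simp only [star_trivial] at h3
    linarith
  exact_mod_cast Finset.prod_induction _ (fun x : ℝ => 1 ≤ x)
    (fun a b ha hb => one_le_mul_of_one_le_of_one_le ha hb) le_rfl fun i _ => key i

theorem det_le_det_add {A B : Matrix n n ℝ} (hA : A.PosDef) (hB : B.PosSemidef) :
    A.det ≤ (A + B).det := by
  obtain ⟨C, hC⟩ : ∃ C : Matrix n n ℝ, A = Cᴴ * C := by
    open scoped MatrixOrder in
    exact CStarAlgebra.nonneg_iff_eq_star_mul_self.mp hA.posSemidef.nonneg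
  have hdet : A.det = C.det * C.det := by
    rw [hC, det_mul, conjTranspose_eq_transpose_of_trivial, det_transpose]
  have hpos : 0 < A.det := hA.det_pos
  have hu : IsUnit C.det := by
    refine isUnit_iff_ne_zero.mpr fun h => ?_
    rw [hdet, h] at hpos
    simp at hpos
  have hS := hB.conjTranspose_mul_mul_same C⁻¹
  have hfac : A + B = Cᴴ * (1 + C⁻¹ᴴ * B * C⁻¹) * C := by
    have e1 : C⁻¹ * C = 1 := nonsing_inv_mul C hu
    have e2 : Cᴴ * C⁻¹ᴴ = 1 := by rw [← conjTranspose_mul, e1, conjTranspose_one]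
    calc A + B = Cᴴ * C + (Cᴴ * C⁻¹ᴴ) * B * (C⁻¹ * C) := by rw [e1, e2, ← hC]; simp
      _ = _ := by noncomm_ring
  have h1 := one_le_det_one_add hS
  rw [hfac, det_mul, det_mul, conjTranspose_eq_transpose_of_trivial C, det_transpose]
  nlinarith

/-- The arithmetic-geometric inequality for the eigenvalues, in logarithmic form. -/
theorem log_det_le_trace_sub_card {A : Matrix n n ℝ} (hA : A.PosDef) :
    Real.log A.det ≤ A.trace - Fintype.card n := by
  have h1 : A.det = ∏ i, hA.1.eigenvalues i := by
    simpa using hA.1.det_eq_prod_eigenvalues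
  have h2 : A.trace = ∑ i, hA.1.eigenvalues i := by
    simpa using hA.1.trace_eq_sum_eigenvalues
  have h3 : (Fintype.card n : ℝ) = ∑ _i : n, (1 : ℝ) := by simp
  rw [h1, h2, h3, Real.log_prod (fun i _ => (hA.eigenvalues_pos i).ne'), ← Finset.sum_sub_distrib]
  exact Finset.sum_le_sum fun i _ => Real.log_le_sub_one_of_pos (hA.eigenvalues_pos i)

theorem log_det_le_smul_trace {A : Matrix n n ℝ} (hA : A.PosDef) {t : ℝ} (ht : 0 < t) :
    Real.log A.det ≤ t * A.trace - Fintype.card n - Fintype.card n * Real.log t := by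
  have h := log_det_le_trace_sub_card (hA.smul ht)
  rw [det_smul, Real.log_mul (pow_pos ht _).ne' hA.det_pos.ne', Real.log_pow, trace_smul,
    smul_eq_mul] at h
  linarith

/-- If `W` is nonnegative as a quadratic form, not necessarily symmetric, and `F` is positive
semidefinite, then `1 + W F` is invertible: a kernel vector `v` has
`⟨v, F v⟩ = -⟨W F v, F v⟩ ≤ 0`, hence `F v = 0` and `v = - W F v = 0`. -/
theorem isUnit_det_one_add_mul {W F : Matrix n n ℝ} (hW : ∀ c, 0 ≤ c ⬝ᵥ (W *ᵥ c))
    (hF : F.PosSemidef) : IsUnit (1 + W * F).det := by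
  rw [isUnit_iff_ne_zero]
  intro h0
  obtain ⟨v, hv, hv0⟩ := exists_mulVec_eq_zero_iff.mpr h0
  rw [add_mulVec, one_mulVec, ← mulVec_mulVec] at hv0
  have h1 : v = -(W *ᵥ (F *ᵥ v)) := eq_neg_of_add_eq_zero_left hv0
  have h2 := hF.dotProduct_mulVec_nonneg v
  have h3 : v ⬝ᵥ (F *ᵥ v) = -((F *ᵥ v) ⬝ᵥ (W *ᵥ (F *ᵥ v))) := by
    conv_lhs => rw [h1]
    rw [← h1, dotProduct_comm, ← dotProduct_neg, ← h1]
  have h4 := hW (F *ᵥ v)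
  simp only [star_trivial] at h2
  have h5 : star v ⬝ᵥ (F *ᵥ v) = 0 := by simp only [star_trivial]; linarith
  have h6 := (hF.dotProduct_mulVec_zero_iff v).mp h5
  rw [h6] at h1
  exact hv (by simpa using h1)

end Matrices

/-! ### A weighted second derivative on an interval -/

/-- Integrating by parts twice against the parabola `(t - a) (b - t)` kills the boundary terms in
`w'`, so that only the boundary values of `w` remain. -/
theorem lintegral_parabola_mul_deriv2_le_of_Icc {w w1 w2 : ℝ → ℝ} {a b : ℝ} (hab : a < b)
    (h1 : ∀ t ∈ Icc a b, HasDerivAt w (w1 t) t) (h2 : ∀ t ∈ Icc a b, HasDerivAt w1 (w2 t) t)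
    (hc : ContinuousOn w2 (Icc a b)) (hw2 : ∀ t ∈ Icc a b, 0 ≤ w2 t)
    (hw : ∀ t ∈ Icc a b, 0 ≤ w t) :
    ∫⁻ t in Ioo a b, ENNReal.ofReal ((t - a) * (b - t) * w2 t) ≤
      ENNReal.ofReal ((b - a) * (w a + w b)) := by
  have hu : uIcc a b = Icc a b := uIcc_of_le hab.le
  have hcw : ContinuousOn w (Icc a b) := fun t ht => (h1 t ht).continuousAt.continuousWithinAt
  have hcq : ContinuousOn (fun t => (t - a) * (b - t) * w2 t) (Icc a b) := by fun_prop
  have hder : ∀ t ∈ uIcc a b, HasDerivAt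
      (fun t => (t - a) * (b - t) * w1 t - (a + b - 2 * t) * w t)
      ((t - a) * (b - t) * w2 t + 2 * w t) t := by
    intro t ht
    rw [hu] at ht
    have e1 : HasDerivAt (fun t : ℝ => (t - a) * (b - t)) (a + b - 2 * t) t := by
      have := ((hasDerivAt_id t).sub_const a).mul ((hasDerivAt_id t).const_sub b)
      refine this.congr_deriv ?_
      simp; ring
    have e2 : HasDerivAt (fun t : ℝ => a + b - 2 * t) (-2) t := by
      simpa using ((hasDerivAt_id t).const_mul 2).const_sub (a + b)
    refine ((e1.mul (h2 t ht)).sub (e2.mul (h1 t ht))).congr_deriv ?_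
    ring
  have hci : ContinuousOn (fun t => (t - a) * (b - t) * w2 t + 2 * w t) (uIcc a b) := by
    rw [hu]; fun_prop
  have hint := intervalIntegral.integral_eq_sub_of_hasDerivAt hder hci.intervalIntegrable
  have hI1 : IntervalIntegrable (fun t => (t - a) * (b - t) * w2 t) volume a b :=
    (hu ▸ hcq : ContinuousOn _ (uIcc a b)).intervalIntegrable
  have hI2 : IntervalIntegrable (fun t => 2 * w t) volume a b :=
    (hu ▸ (by fun_prop) : ContinuousOn (fun t => 2 * w t) (uIcc a b)).intervalIntegrable
  rw [intervalIntegral.integral_add hI1 hI2] at hint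
  have hpos : 0 ≤ ∫ t in a..b, 2 * w t :=
    intervalIntegral.integral_nonneg hab.le fun t ht => by have := hw t ht; positivity
  rw [restrict_Ioo_eq_restrict_Ioc, ← ofReal_integral_eq_lintegral_ofReal,
    ← intervalIntegral.integral_of_le hab.le]
  · refine ENNReal.ofReal_le_ofReal ?_
    have : (∫ t in a..b, (t - a) * (b - t) * w2 t) =
        (b - a) * (w a + w b) - ∫ t in a..b, 2 * w t := by
      rw [eq_sub_iff_add_eq, hint]; ring
    linarith
  · exact hI1.1
  · refine (ae_restrict_mem measurableSet_Ioc).mono fun t ht => ?_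
    have := hw2 t ⟨ht.1.le, ht.2⟩
    have h3 := ht.1.le
    have h4 := ht.2
    exact mul_nonneg (mul_nonneg (by linarith) (by linarith)) this

/-- The same bound without regularity at the endpoints, by Fatou's lemma on the intervals
`[a + s_n, b - s_n]` exhausting `(a, b)`. -/
theorem lintegral_parabola_mul_deriv2_le {w w1 w2 : ℝ → ℝ} {a b : ℝ} (hab : a < b)
    (hcw : ContinuousOn w (Icc a b))
    (h1 : ∀ t ∈ Ioo a b, HasDerivAt w (w1 t) t) (h2 : ∀ t ∈ Ioo a b, HasDerivAt w1 (w2 t) t)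
    (hc : ContinuousOn w2 (Ioo a b)) (hw2 : ∀ t ∈ Ioo a b, 0 ≤ w2 t)
    (hw : ∀ t ∈ Icc a b, 0 ≤ w t) :
    ∫⁻ t in Ioo a b, ENNReal.ofReal ((t - a) * (b - t) * w2 t) ≤
      ENNReal.ofReal ((b - a) * (w a + w b)) := by
  let s : ℕ → ℝ := fun n => (b - a) / 2 * (1 / ((n : ℝ) + 2))
  have hspos : ∀ n, 0 < s n := fun n => by
    have : 0 < b - a := by linarith
    positivity
  have hs2 : ∀ n, s n < (b - a) / 2 := fun n => by
    have h0 : 0 < b - a := by linarith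
    have : 1 / ((n : ℝ) + 2) < 1 := by
      rw [div_lt_one (by positivity)]
      have : (0 : ℝ) ≤ n := n.cast_nonneg
      linarith
    change (b - a) / 2 * (1 / ((n : ℝ) + 2)) < (b - a) / 2
    exact mul_lt_of_lt_one_right (by positivity) this
  have hs0 : Filter.Tendsto s Filter.atTop (nhds 0) := by
    have h := (tendsto_one_div_add_atTop_nhds_zero_nat (𝕜 := ℝ)).comp
      (Filter.tendsto_add_atTop_nat 1)
    have h' := h.const_mul ((b - a) / 2)
    rw [mul_zero] at h'
    refine h'.congr fun n => ?_
    simp only [s, Function.comp]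
    push_cast
    rw [add_assoc, one_add_one_eq_two]
  let g : ℕ → ℝ → ENNReal := fun n => (Ioo (a + s n) (b - s n)).indicator
    fun t => ENNReal.ofReal ((t - (a + s n)) * ((b - s n) - t) * w2 t)
  have hsub : ∀ n, Icc (a + s n) (b - s n) ⊆ Ioo a b := fun n t ht =>
    ⟨by linarith [ht.1, hspos n], by linarith [ht.2, hspos n]⟩
  have hgm : ∀ n, AEMeasurable (g n) (volume.restrict (Ioo a b)) := by
    intro n
    refine AEMeasurable.indicator ?_ measurableSet_Ioo
    refine ENNReal.measurable_ofReal.comp_aemeasurable ?_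
    exact ContinuousOn.aemeasurable (by fun_prop) measurableSet_Ioo
  have hlim : ∀ t ∈ Ioo a b, ENNReal.ofReal ((t - a) * (b - t) * w2 t) ≤
      Filter.liminf (fun n => g n t) Filter.atTop := by
    intro t ht
    have hev : ∀ᶠ n in Filter.atTop, g n t =
        ENNReal.ofReal ((t - (a + s n)) * ((b - s n) - t) * w2 t) := by
      have hm : 0 < min (t - a) (b - t) := lt_min (by linarith [ht.1]) (by linarith [ht.2])
      filter_upwards [hs0.eventually (gt_mem_nhds hm)] with n hn
      have h5 := lt_min_iff.mp hn
      exact indicator_of_mem (show t ∈ Ioo (a + s n) (b - s n) from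
        ⟨by linarith [h5.1], by linarith [h5.2]⟩) _
    have ht' : Filter.Tendsto (fun n => g n t) Filter.atTop
        (nhds (ENNReal.ofReal ((t - a) * (b - t) * w2 t))) := by
      refine Filter.Tendsto.congr' (hev.mono fun n hn => hn.symm) ?_
      refine ENNReal.tendsto_ofReal ?_
      have e1 : Filter.Tendsto (fun n => t - (a + s n)) Filter.atTop (nhds (t - a)) := by
        simpa using (hs0.const_add a).const_sub t
      have e2 : Filter.Tendsto (fun n => (b - s n) - t) Filter.atTop (nhds (b - t)) := by
        simpa using (hs0.const_sub b).sub_const t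
      exact (e1.mul e2).mul_const _
    exact ht'.liminf_eq.ge
  have hbound : ∀ n, ∫⁻ t in Ioo a b, g n t ≤
      ENNReal.ofReal (((b - s n) - (a + s n)) * (w (a + s n) + w (b - s n))) := by
    intro n
    have hlt : a + s n < b - s n := by linarith [hs2 n]
    have h6 : Ioo (a + s n) (b - s n) ⊆ Ioo a b := Ioo_subset_Icc_self.trans (hsub n)
    rw [lintegral_indicator measurableSet_Ioo, Measure.restrict_restrict measurableSet_Ioo,
      inter_eq_left.mpr h6]
    exact lintegral_parabola_mul_deriv2_le_of_Icc hlt (fun t ht => h1 t (hsub n ht))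
      (fun t ht => h2 t (hsub n ht)) (hc.mono (hsub n)) (fun t ht => hw2 t (hsub n ht))
      (fun t ht => hw t (Ioo_subset_Icc_self (hsub n ht)))
  have hlimR : Filter.Tendsto (fun n => ENNReal.ofReal
      (((b - s n) - (a + s n)) * (w (a + s n) + w (b - s n)))) Filter.atTop
      (nhds (ENNReal.ofReal ((b - a) * (w a + w b)))) := by
    refine ENNReal.tendsto_ofReal (Filter.Tendsto.mul ?_ (Filter.Tendsto.add ?_ ?_))
    · simpa using (hs0.const_sub b).sub (hs0.const_add a)
    · refine (hcw a (left_mem_Icc.mpr hab.le)).tendsto.comp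
        (tendsto_nhdsWithin_iff.mpr ⟨by simpa using hs0.const_add a, .of_forall fun n => ?_⟩)
      exact ⟨by linarith [hspos n], by linarith [hs2 n]⟩
    · refine (hcw b (right_mem_Icc.mpr hab.le)).tendsto.comp
        (tendsto_nhdsWithin_iff.mpr ⟨by simpa using hs0.const_sub b, .of_forall fun n => ?_⟩)
      exact ⟨by linarith [hs2 n], by linarith [hspos n]⟩
  calc ∫⁻ t in Ioo a b, ENNReal.ofReal ((t - a) * (b - t) * w2 t)
      ≤ ∫⁻ t in Ioo a b, Filter.liminf (fun n => g n t) Filter.atTop :=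
        setLIntegral_mono' measurableSet_Ioo hlim
    _ ≤ Filter.liminf (fun n => ∫⁻ t in Ioo a b, g n t) Filter.atTop := lintegral_liminf_le' hgm
    _ ≤ Filter.liminf (fun n => ENNReal.ofReal
      (((b - s n) - (a + s n)) * (w (a + s n) + w (b - s n)))) Filter.atTop :=
        Filter.liminf_le_liminf (.of_forall hbound)
    _ = _ := hlimR.liminf_eq

namespace LabelledPolytope

variable {m : ℕ} (P : LabelledPolytope m)

/-! ### The polytope and its faces -/

theorem mem_Δ {x : E m} : x ∈ P.Δ ↔ ∀ j, 0 ≤ P.L j x := Iff.rfl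

theorem L_combo (j : Fin P.d) {a b : ℝ} (hab : a + b = 1) (x y : E m) :
    P.L j (a • x + b • y) = a * P.L j x + b * P.L j y := by
  simp only [L, affineLabel, inner_add_right, real_inner_smul_right]
  linear_combination (-P.const j) * hab

theorem L_add (j : Fin P.d) (x v : E m) : P.L j (x + v) = P.L j x + inner ℝ (P.normal j) v := by
  simp only [L, affineLabel, inner_add_right]
  ring

theorem convex_Δ : Convex ℝ P.Δ := by
  intro x hx y hy a b ha hb hab
  refine P.mem_Δ.mpr fun j => ?_
  rw [P.L_combo j hab]
  exact add_nonneg (mul_nonneg ha (hx j)) (mul_nonneg hb (hy j))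

theorem isClosed_Δ : IsClosed P.Δ := P.isCompact.isClosed

theorem measurableSet_Δ : MeasurableSet P.Δ := P.isCompact.measurableSet

theorem isOpen_pos_L : IsOpen {x | ∀ j, 0 < P.L j x} := by
  simp only [ofPred_forall]
  exact isOpen_iInter_of_finite fun j => isOpen_lt continuous_const (P.continuous_L j)

theorem mem_interior_iff {x : E m} : x ∈ interior P.Δ ↔ ∀ j, 0 < P.L j x := by
  refine ⟨fun hx j => ?_, fun hx => ?_⟩
  · refine lt_of_le_of_ne (interior_subset hx j) fun h0 => ?_
    have hc : Filter.Tendsto (fun t : ℝ => x - t • P.normal j) (nhds 0) (nhds x) := by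
      have : Continuous fun t : ℝ => x - t • P.normal j := by fun_prop
      simpa using this.tendsto 0
    have hev := hc.eventually (mem_interior_iff_mem_nhds.mp hx)
    have hpos : ∃ᶠ t : ℝ in nhds 0, 0 < t :=
      (frequently_gt_nhds (0 : ℝ))
    obtain ⟨t, ht, hmem⟩ := (hpos.and_eventually hev).exists
    have h1 := P.mem_Δ.mp hmem j
    rw [sub_eq_add_neg, P.L_add, ← h0, inner_neg_right, real_inner_smul_right,
      real_inner_self_eq_norm_sq] at h1
    have h2 : 0 < ‖P.normal j‖ := norm_pos_iff.mpr (P.normal_ne_zero j)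
    have : 0 < t * ‖P.normal j‖ ^ 2 := by positivity
    linarith
  · exact mem_interior.mpr ⟨_, fun y hy j => (hy j).le, P.isOpen_pos_L, hx⟩

/-- The normals span `ℝ^m`, because `Δ` contains no line. -/
theorem eq_zero_of_inner_normal_eq_zero {v : E m} (hv : ∀ j, inner ℝ (P.normal j) v = 0) :
    v = 0 := by
  by_contra hne
  obtain ⟨x, hx⟩ := P.interior_nonempty
  obtain ⟨R, hR⟩ := P.isCompact.isBounded.exists_norm_le
  have hmem : ∀ t : ℝ, x + t • v ∈ P.Δ := fun t j => by
    change 0 ≤ P.L j (x + t • v)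
    rw [P.L_add, real_inner_smul_right, hv j, mul_zero, add_zero]
    exact interior_subset hx j
  have hpos : 0 < ‖v‖ := norm_pos_iff.mpr hne
  have hR0 : 0 ≤ R := (norm_nonneg _).trans (hR x (interior_subset hx))
  have h1 := hR _ (hmem ((2 * R + 1) / ‖v‖))
  have h2 : ‖((2 * R + 1) / ‖v‖) • v‖ = 2 * R + 1 := by
    rw [norm_smul, Real.norm_of_nonneg (by positivity)]
    field_simp
  have h3 := norm_sub_le (x + ((2 * R + 1) / ‖v‖) • v) x
  rw [add_sub_cancel_left, h2] at h3
  have := hR x (interior_subset hx)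
  linarith

/-- Simplicity holds at every point, not only at vertices: the labels vanishing at `x` also vanish
at some vertex of the smallest face containing `x`. -/
theorem linearIndependent_active {x : E m} (hx : x ∈ P.Δ) :
    LinearIndependent ℝ (fun j : {j // P.L j x = 0} => P.normal j) := by
  let A : Set (E m) := {y | y ∈ P.Δ ∧ ∀ j, P.L j x = 0 → P.L j y = 0}
  have hAeq : A = P.Δ ∩ ⋂ j, ⋂ _ : P.L j x = 0, P.L j ⁻¹' {0} := by
    ext y; simp [A]
  have hAc : IsCompact A := by
    rw [hAeq]
    refine P.isCompact.inter_right (isClosed_iInter fun j => isClosed_iInter fun _ => ?_)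
    exact isClosed_singleton.preimage (P.continuous_L j)
  have hext : IsExtreme ℝ P.Δ A := by
    refine ⟨fun y hy => hy.1, ?_⟩
    intro y hy z hz w hw hwo
    refine ⟨hy, fun j hj => ?_⟩
    obtain ⟨a, b, ha, hb, hab, rfl⟩ := hwo
    have h1 := hw.2 j hj
    rw [P.L_combo j hab] at h1
    have h2 := P.mem_Δ.mp hy j
    have h3 := P.mem_Δ.mp hz j
    have h4 : a * P.L j y = 0 := by nlinarith [mul_nonneg ha.le h2, mul_nonneg hb.le h3]
    exact (mul_eq_zero.mp h4).resolve_left ha.ne'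
  obtain ⟨p, hp⟩ := hAc.extremePoints_nonempty ⟨x, hx, fun j hj => hj⟩
  have hpA : p ∈ A := hp.1
  have hli := P.linearIndependent_vertex p (hext.extremePoints_subset_extremePoints hp)
  let φ : {j // P.L j x = 0} → {j // affineLabel (P.normal j) (P.const j) p = 0} :=
    fun j => ⟨j.1, hpA.2 j.1 j.2⟩
  have hφ : Function.Injective φ := fun i j hij => by
    simpa [φ, Subtype.ext_iff] using hij
  exact hli.comp φ hφ

/-- A common bound for the labels on `Δ` and for the lengths of the normals. -/
theorem exists_bound : ∃ M : ℝ, 1 ≤ M ∧ (∀ j, ∀ x ∈ P.Δ, P.L j x ≤ M) ∧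
    ∀ j, ‖P.normal j‖ ≤ M := by
  have h1 : ∀ j, ∃ B : ℝ, ∀ x ∈ P.Δ, P.L j x ≤ B := fun j => by
    obtain ⟨B, hB⟩ := P.isCompact.exists_bound_of_continuousOn (P.continuous_L j).continuousOn
    exact ⟨B, fun x hx => (le_abs_self _).trans (hB x hx)⟩
  choose B hB using h1
  refine ⟨1 + ∑ j, (|B j| + ‖P.normal j‖), ?_, fun j x hx => ?_, fun j => ?_⟩
  · have : 0 ≤ ∑ j, (|B j| + ‖P.normal j‖) := Finset.sum_nonneg fun j _ => by positivity
    linarith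
  all_goals
    have h2 := Finset.single_le_sum (f := fun j => |B j| + ‖P.normal j‖)
      (fun j _ => by positivity) (Finset.mem_univ j)
  · linarith [hB j x hx, le_abs_self (B j), norm_nonneg (P.normal j)]
  · linarith [abs_nonneg (B j)]

/-! ### Continuous functions on the polytope -/

theorem ext_apply (f : C(P.Δ, ℝ)) {x : E m} (hx : x ∈ P.Δ) : P.ext f x = f ⟨x, hx⟩ :=
  Subtype.val_injective.extend_apply f 0 ⟨x, hx⟩

theorem ext_apply_of_notMem (f : C(P.Δ, ℝ)) {x : E m} (hx : x ∉ P.Δ) : P.ext f x = 0 := by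
  rw [ext, Function.extend_apply']
  · rfl
  · rintro ⟨a, rfl⟩
    exact hx a.2

theorem continuousOn_ext (f : C(P.Δ, ℝ)) : ContinuousOn (P.ext f) P.Δ := by
  rw [continuousOn_iff_continuous_domRestrict]
  refine f.continuous.congr fun x => ?_
  exact (P.ext_apply f x.2).symm

theorem measurable_ext (f : C(P.Δ, ℝ)) : Measurable (P.ext f) :=
  (MeasurableEmbedding.subtype_coe P.measurableSet_Δ).measurable_extend f.continuous.measurable
    measurable_const

theorem abs_ext_le (f : C(P.Δ, ℝ)) (x : E m) : |P.ext f x| ≤ ‖f‖ := by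
  by_cases hx : x ∈ P.Δ
  · rw [P.ext_apply f hx]
    exact f.norm_coe_le_norm _
  · rw [P.ext_apply_of_notMem f hx, abs_zero]
    exact norm_nonneg f

theorem ext_add (f g : C(P.Δ, ℝ)) : P.ext (f + g) = fun x => P.ext f x + P.ext g x := by
  ext x
  by_cases hx : x ∈ P.Δ
  · simp [P.ext_apply _ hx]
  · simp [P.ext_apply_of_notMem _ hx]

theorem ext_smul (r : ℝ) (f : C(P.Δ, ℝ)) : P.ext (r • f) = fun x => r * P.ext f x := by
  ext x
  by_cases hx : x ∈ P.Δ
  · simp [P.ext_apply _ hx]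
  · simp [P.ext_apply_of_notMem _ hx]

theorem integrable_ext_σ (f : C(P.Δ, ℝ)) : Integrable (P.ext f) P.σ :=
  Integrable.of_bound (P.measurable_ext f).aestronglyMeasurable ‖f‖
    (.of_forall fun x => P.abs_ext_le f x)

theorem integrableOn_mul_ext (s : E m →ᵃ[ℝ] ℝ) (f : C(P.Δ, ℝ)) :
    IntegrableOn (fun x => s x * P.ext f x) P.Δ :=
  (s.continuous_of_finiteDimensional.continuousOn.mul (P.continuousOn_ext f)).integrableOn_compact
    P.isCompact

theorem integrableOn_ext (f : C(P.Δ, ℝ)) : IntegrableOn (P.ext f) P.Δ :=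
  (P.continuousOn_ext f).integrableOn_compact P.isCompact

theorem volume_Δ_lt_top : volume P.Δ < ⊤ := P.isCompact.measure_lt_top

theorem volume_real_Δ_pos : 0 < volume.real P.Δ :=
  ENNReal.toReal_pos ((isOpen_interior.measure_pos _ P.interior_nonempty).trans_le
    (measure_mono interior_subset)).ne' P.volume_Δ_lt_top.ne

/-! ### The Donaldson–Futaki invariant -/

theorem futaki_add (f g : C(P.Δ, ℝ)) : P.futaki (f + g) = P.futaki f + P.futaki g := by
  simp only [futaki, P.ext_add, mul_add]
  rw [integral_add (P.integrable_ext_σ f) (P.integrable_ext_σ g),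
    integral_add (P.integrableOn_mul_ext _ f) (P.integrableOn_mul_ext _ g)]
  ring

theorem futaki_smul (r : ℝ) (f : C(P.Δ, ℝ)) : P.futaki (r • f) = r * P.futaki f := by
  simp only [futaki, P.ext_smul, mul_left_comm _ r, integral_const_mul]
  ring

theorem futaki_eq_zero_of_isAffine {g : C(P.Δ, ℝ)} (hg : P.IsAffine g) : P.futaki g = 0 := by
  obtain ⟨a, ha⟩ := hg
  have hext : ∀ x ∈ P.Δ, P.ext g x = a x := fun x hx => by rw [P.ext_apply g hx, ha]
  rw [futaki, integral_congr_ae (P.ae_mem_Δ.mono hext),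
    setIntegral_congr_fun (g := fun x => P.extremal x * a x) P.measurableSet_Δ
      (fun x hx => by simp only [hext x hx])]
  exact P.existsUnique_extremal.choose_spec.1 a

theorem futaki_eq_of_isAffine_sub {f h : C(P.Δ, ℝ)} (hfh : P.IsAffine (f - h)) :
    P.futaki f = P.futaki h := by
  have := P.futaki_add (f - h) h
  rw [P.futaki_eq_zero_of_isAffine hfh, sub_add_cancel, zero_add] at this
  exact this

theorem exists_extremal_bound : ∃ B : ℝ, 0 ≤ B ∧ ∀ x ∈ P.Δ, |P.extremal x| ≤ B := by
  obtain ⟨B, hB⟩ := P.isCompact.exists_bound_of_continuousOn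
    P.extremal.continuous_of_finiteDimensional.continuousOn
  exact ⟨|B|, abs_nonneg B, fun x hx => (hB x hx).trans (le_abs_self B)⟩

theorem exists_futaki_le_norm : ∃ K : ℝ, 0 ≤ K ∧ ∀ f, P.futaki f ≤ K * ‖f‖ := by
  obtain ⟨B, hB0, hB⟩ := P.exists_extremal_bound
  refine ⟨2 * P.σ.real univ + B * volume.real P.Δ, by positivity, fun f => ?_⟩
  have h1 : ∫ x, P.ext f x ∂P.σ ≤ ‖f‖ * P.σ.real univ :=
    (Real.le_norm_self _).trans
      (norm_integral_le_of_norm_le_const (.of_forall fun x => P.abs_ext_le f x))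
  have h2 : ‖∫ x in P.Δ, P.extremal x * P.ext f x‖ ≤ B * ‖f‖ * volume.real P.Δ := by
    refine norm_setIntegral_le_of_norm_le_const P.volume_Δ_lt_top fun x hx => ?_
    rw [norm_mul]
    exact mul_le_mul (hB x hx) (P.abs_ext_le f x) (abs_nonneg _) hB0
  have h3 := neg_le_of_abs_le h2
  rw [futaki]
  linarith

/-- The boundary integral is controlled by the invariant and the `L^1` norm. -/
theorem two_mul_integral_σ_le {B : ℝ} (hB : ∀ x ∈ P.Δ, |P.extremal x| ≤ B)
    (f : C(P.Δ, ℝ)) :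
    2 * ∫ x, P.ext f x ∂P.σ ≤ P.futaki f + B * ∫ x in P.Δ, |P.ext f x| := by
  have h : ∫ x in P.Δ, P.extremal x * P.ext f x ≤ ∫ x in P.Δ, B * |P.ext f x| := by
    refine setIntegral_mono_on (P.integrableOn_mul_ext _ f)
      ((P.integrableOn_ext f).abs.const_mul B) P.measurableSet_Δ fun x hx => ?_
    refine (le_abs_self _).trans ?_
    rw [abs_mul]
    exact mul_le_mul_of_nonneg_right (hB x hx) (abs_nonneg _)
  rw [integral_const_mul] at h
  rw [futaki]
  linarith

end LabelledPolytope

/-! ### Slicing by coordinate lines -/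

/-- The point with `i`-th coordinate `t` and remaining coordinates `y`. -/
def insertCoord {n : ℕ} (i : Fin (n + 1)) (t : ℝ) (y : E n) : E (n + 1) :=
  WithLp.toLp 2 (i.insertNth t y.ofLp)

theorem insertCoord_eq {n : ℕ} (i : Fin (n + 1)) (t : ℝ) (y : E n) :
    insertCoord i t y = insertCoord i 0 y + t • EuclideanSpace.single i 1 := by
  ext k
  refine Fin.succAboveCases i ?_ (fun k => ?_) k
  · simp [insertCoord]
  · simp [insertCoord]

theorem continuous_insertCoord {n : ℕ} (i : Fin (n + 1)) :
    Continuous fun p : ℝ × E n => insertCoord i p.1 p.2 := by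
  refine (PiLp.continuous_toLp 2 _).comp (continuous_pi fun k => ?_)
  refine Fin.succAboveCases i ?_ (fun k => ?_) k
  · simpa using continuous_fst
  · simp only [Fin.insertNth_apply_succAbove]
    fun_prop

/-- Fubini's theorem along the `i`-th coordinate axis. -/
theorem lintegral_eq_lintegral_insertCoord {n : ℕ} (i : Fin (n + 1)) {F : E (n + 1) → ENNReal}
    (hF : Measurable F) : ∫⁻ x, F x = ∫⁻ y : E n, ∫⁻ t : ℝ, F (insertCoord i t y) := by
  have h1 := (PiLp.volume_preserving_toLp (Fin (n + 1))).lintegral_comp hF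
  have h2 := (volume_preserving_piFinSuccAbove (fun _ : Fin (n + 1) => ℝ) i).symm.lintegral_comp
    (hF.comp (PiLp.continuous_toLp 2 (fun _ : Fin (n + 1) => ℝ)).measurable)
  rw [← h1]
  simp only [Function.comp] at h2
  rw [← h2, Measure.volume_eq_prod, lintegral_prod_symm]
  · have hG : Measurable fun y : E n => ∫⁻ t : ℝ, F (insertCoord i t y) :=
      Measurable.lintegral_prod_left (hF.comp (continuous_insertCoord i).measurable)
    rw [← (PiLp.volume_preserving_toLp (Fin n)).lintegral_comp hG]
    rfl
  · exact (hF.comp ((PiLp.continuous_toLp 2 _).measurable.comp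
      (MeasurableEquiv.measurable _))).aemeasurable

theorem dist_le_dist_insertCoord {n : ℕ} (i : Fin (n + 1)) (t t' : ℝ) (y y' : E n) :
    dist y y' ≤ dist (insertCoord i t y) (insertCoord i t' y') := by
  rw [EuclideanSpace.dist_eq, EuclideanSpace.dist_eq]
  refine Real.sqrt_le_sqrt ?_
  rw [Fin.sum_univ_succAbove _ i]
  simp only [insertCoord, Fin.insertNth_apply_succAbove]
  exact le_add_of_nonneg_left (sq_nonneg _)

/-- Lebesgue measure pushed forward by a map that does not decrease distances is at most the
`n`-dimensional Hausdorff measure. -/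
theorem map_volume_le_of_antilipschitz {n m : ℕ} {γ : E n → E m} (hm : Measurable γ)
    (hγ : AntilipschitzWith 1 γ) :
    (volume : Measure (E n)).map γ ≤ Measure.euclideanHausdorffMeasure n := by
  refine Measure.le_iff.mpr fun s hs => ?_
  rw [Measure.map_apply hm hs, ← EuclideanSpace.euclideanHausdorffMeasure_eq_volume,
    Measure.euclideanHausdorffMeasure_def, Measure.euclideanHausdorffMeasure_def]
  simp only [Measure.smul_apply]
  have h := hγ.hausdorffMeasure_preimage_le (d := (n : ℝ)) n.cast_nonneg s
  rw [ENNReal.coe_one, ENNReal.one_rpow, one_mul] at h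
  exact smul_le_smul_of_nonneg_left h zero_le

theorem hasDerivAt_line {V : Type*} [NormedAddCommGroup V] [NormedSpace ℝ V] {U : Set V}
    (hU : IsOpen U) {f : V → ℝ} (hf : ContDiffOn ℝ ∞ f U) {z e : V} {t : ℝ}
    (ht : z + t • e ∈ U) :
    HasDerivAt (fun t : ℝ => f (z + t • e)) (fderiv ℝ f (z + t • e) e) t ∧
    HasDerivAt (fun t : ℝ => fderiv ℝ f (z + t • e) e)
      (fderiv ℝ (fderiv ℝ f) (z + t • e) e e) t := by
  have hl : HasDerivAt (fun t : ℝ => z + t • e) e t := by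
    simpa using ((hasDerivAt_id t).smul_const e).const_add z
  have h1 : DifferentiableAt ℝ f (z + t • e) :=
    (hf.differentiableOn (by simp)).differentiableAt (hU.mem_nhds ht)
  have h0 : ContDiffOn ℝ ∞ (fderiv ℝ f) U := hf.fderiv_of_isOpen hU (by simp)
  have h2 : DifferentiableAt ℝ (fderiv ℝ f) (z + t • e) :=
    (h0.differentiableOn (by simp)).differentiableAt (hU.mem_nhds ht)
  have h3 : HasDerivAt (fun t : ℝ => fderiv ℝ f (z + t • e))
      (fderiv ℝ (fderiv ℝ f) (z + t • e) e) t := h2.hasFDerivAt.comp_hasDerivAt t hl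
  refine ⟨h1.hasFDerivAt.comp_hasDerivAt t hl, ?_⟩
  simpa using h3.clm_apply (hasDerivAt_const t e)

namespace LabelledPolytope

variable {m : ℕ} (P : LabelledPolytope m)

/-! ### The weighted trace of the Hessian -/

theorem prod_L_le {M : ℝ} (hM0 : 0 ≤ M) (hM : ∀ j, ∀ x ∈ P.Δ, P.L j x ≤ M) (j : Fin P.d) {x : E m}
    (hx : x ∈ P.Δ) {r : ℝ} (hr : P.L j x ≤ M * r) : ∏ i, P.L i x ≤ M ^ P.d * r := by
  have hL := P.mem_Δ.mp hx
  have h1 : ∏ i ∈ Finset.univ.erase j, P.L i x ≤ M ^ (P.d - 1) := by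
    refine (Finset.prod_le_prod (fun i _ => hL i) fun i _ => hM i x hx).trans_eq ?_
    simp
  have hd : P.d ≠ 0 := (Fin.pos j).ne'
  rw [← Finset.mul_prod_erase _ _ (Finset.mem_univ j)]
  calc P.L j x * ∏ i ∈ Finset.univ.erase j, P.L i x
      ≤ P.L j x * M ^ (P.d - 1) := mul_le_mul_of_nonneg_left h1 (hL j)
    _ ≤ (M * r) * M ^ (P.d - 1) := mul_le_mul_of_nonneg_right hr (pow_nonneg hM0 _)
    _ = M ^ P.d * r := by rw [mul_right_comm, mul_pow_sub_one hd]

/-- A line in direction `e` meets `Δ` in a segment whose endpoints lie on two of the hyperplanes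
`L_j = 0` transverse to `e`, at parameter `-L_j(z) / ⟨u_j, e⟩`. The product of the labels is
bounded by a multiple of the distance to either endpoint, so the parabola estimate on the segment
applies. -/
theorem lintegral_line_le {M : ℝ} (hM1 : 1 ≤ M) (hM : ∀ j, ∀ x ∈ P.Δ, P.L j x ≤ M)
    (hMu : ∀ j, ‖P.normal j‖ ≤ M) {v : C(P.Δ, ℝ)}
    (hv : ContDiffOn ℝ ∞ (P.ext v) (interior P.Δ)) (hv0 : ∀ x, 0 ≤ P.ext v x) {e : E m}
    (he : ‖e‖ = 1)
    (hconv : ∀ x ∈ interior P.Δ, 0 ≤ fderiv ℝ (fderiv ℝ (P.ext v)) x e e) (z : E m) :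
    ∫⁻ t : ℝ, (interior P.Δ).indicator (fun x => ENNReal.ofReal
        ((∏ j, P.L j x) * fderiv ℝ (fderiv ℝ (P.ext v)) x e e)) (z + t • e) ≤
      ENNReal.ofReal (2 * M ^ P.d) * ∑ j with inner ℝ (P.normal j) e ≠ 0,
        ENNReal.ofReal (P.ext v (z + (-P.L j z / inner ℝ (P.normal j) e) • e)) := by
  by_cases hex : ∃ t : ℝ, z + t • e ∈ interior P.Δ
  swap
  · push Not at hex
    simp [indicator_of_notMem (hex _)]
  obtain ⟨t₀, ht₀⟩ := hex
  have hM0 : 0 ≤ M := by linarith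
  have hLt : ∀ j t, P.L j (z + t • e) = P.L j z + t * inner ℝ (P.normal j) e := fun j t => by
    rw [P.L_add, real_inner_smul_right]
  have hcl : Continuous fun t : ℝ => z + t • e := by fun_prop
  let T : Set ℝ := {t | z + t • e ∈ P.Δ}
  have hTcl : IsClosed T := P.isClosed_Δ.preimage hcl
  have hTb : Bornology.IsBounded T := by
    obtain ⟨R, hR⟩ := P.isCompact.isBounded.exists_norm_le
    refine (Metric.isBounded_iff_subset_closedBall 0).mpr ⟨R + ‖z‖, fun t ht => ?_⟩
    have h1 := hR _ ht
    have h2 := norm_sub_le (z + t • e) z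
    rw [add_sub_cancel_left, norm_smul, he, mul_one] at h2
    rw [mem_closedBall_zero_iff]
    linarith
  have hTc : IsCompact T := Metric.isCompact_of_isClosed_isBounded hTcl hTb
  have hTne : T.Nonempty := ⟨t₀, interior_subset (s := P.Δ) ht₀⟩
  set a := sInf T with ha
  set b := sSup T with hb
  have haT : a ∈ T := hTc.sInf_mem hTne
  have hbT : b ∈ T := hTc.sSup_mem hTne
  have hTa : ∀ t ∈ T, a ≤ t := fun t ht => csInf_le hTc.bddBelow ht
  have hTb : ∀ t ∈ T, t ≤ b := fun t ht => le_csSup hTc.bddAbove ht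
  have hLpos := P.mem_interior_iff.mp ht₀
  have hzero : ∀ s ∈ T, z + s • e ∉ interior P.Δ → ∃ j, P.L j (z + s • e) = 0 := by
    intro s hs hsi
    by_contra! hne
    exact hsi (P.mem_interior_iff.mpr fun j => lt_of_le_of_ne (P.mem_Δ.mp hs j) (hne j).symm)
  have hevT : ∀ s, z + s • e ∈ interior P.Δ → ∀ᶠ t in nhds s, t ∈ T := fun s hs =>
    (hcl.tendsto s).eventually (mem_interior_iff_mem_nhds.mp hs)
  have hani : z + a • e ∉ interior P.Δ := fun h => by
    obtain ⟨t, ht, htT⟩ := ((frequently_lt_nhds a).and_eventually (hevT a h)).exists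
    exact absurd (hTa t htT) (not_le.mpr ht)
  have hbni : z + b • e ∉ interior P.Δ := fun h => by
    obtain ⟨t, ht, htT⟩ := ((frequently_gt_nhds b).and_eventually (hevT b h)).exists
    exact absurd (hTb t htT) (not_le.mpr ht)
  obtain ⟨ja, hja⟩ := hzero a haT hani
  obtain ⟨jb, hjb⟩ := hzero b hbT hbni
  have hparam : ∀ j s, P.L j (z + s • e) = 0 → inner ℝ (P.normal j) e ≠ 0 ∧
      s = -P.L j z / inner ℝ (P.normal j) e := by
    intro j s hs
    have h1 := hLpos j
    rw [hLt] at hs h1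
    have h2 : inner ℝ (P.normal j) e ≠ 0 := by
      intro h0
      rw [h0] at hs h1
      linarith
    refine ⟨h2, ?_⟩
    rw [eq_div_iff h2]
    linarith
  have hinterior : ∀ t, z + t • e ∈ interior P.Δ ↔ t ∈ Ioo a b := by
    intro t
    constructor
    · intro ht
      refine ⟨lt_of_le_of_ne (hTa t (interior_subset (s := P.Δ) ht)) ?_,
        lt_of_le_of_ne (hTb t (interior_subset (s := P.Δ) ht)) ?_⟩
      · rintro rfl; exact hani ht
      · rintro rfl; exact hbni ht
    · intro ht
      refine P.mem_interior_iff.mpr fun j => ?_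
      have e1 := P.mem_Δ.mp haT j
      have e2 := P.mem_Δ.mp hbT j
      have e3 := hLpos j
      rw [hLt] at e1 e2 e3 ⊢
      rcases lt_trichotomy (inner ℝ (P.normal j) e) 0 with h | h | h
      · nlinarith [ht.2]
      · rw [h] at e3 ⊢; linarith
      · nlinarith [ht.1]
  have hab : a < b := ((hinterior t₀).mp ht₀).1.trans ((hinterior t₀).mp ht₀).2
  have habs : ∀ j, |inner ℝ (P.normal j) e| ≤ M := fun j => by
    have := abs_real_inner_le_norm (P.normal j) e
    rw [he, mul_one] at this
    exact this.trans (hMu j)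
  have hφ : ∀ t ∈ Ioo a b, (b - a) * ∏ j, P.L j (z + t • e) ≤
      2 * M ^ P.d * ((t - a) * (b - t)) := by
    intro t ht
    have htΔ : z + t • e ∈ P.Δ := interior_subset ((hinterior t).mpr ht)
    have e1 : ∏ j, P.L j (z + t • e) ≤ M ^ P.d * (t - a) := by
      refine P.prod_L_le hM0 hM ja htΔ ?_
      rw [hLt] at hja ⊢
      nlinarith [le_abs_self (inner ℝ (P.normal ja) e), habs ja, ht.1]
    have e2 : ∏ j, P.L j (z + t • e) ≤ M ^ P.d * (b - t) := by
      refine P.prod_L_le hM0 hM jb htΔ ?_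
      rw [hLt] at hjb ⊢
      nlinarith [neg_abs_le (inner ℝ (P.normal jb) e), habs jb, ht.2]
    nlinarith [mul_le_mul_of_nonneg_right e1 (sub_nonneg.mpr ht.2.le),
      mul_le_mul_of_nonneg_right e2 (sub_nonneg.mpr ht.1.le)]
  have h2cont : ContinuousOn (fun x => fderiv ℝ (fderiv ℝ (P.ext v)) x e e) (interior P.Δ) := by
    have h1 := (hv.fderiv_of_isOpen (m := ∞) isOpen_interior (by simp)).fderiv_of_isOpen
      (m := ∞) isOpen_interior (by simp)
    exact (h1.continuousOn.clm_apply continuousOn_const).clm_apply continuousOn_const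
  have hmap : MapsTo (fun t : ℝ => z + t • e) (Ioo a b) (interior P.Δ) :=
    fun t ht => (hinterior t).mpr ht
  have h1d := lintegral_parabola_mul_deriv2_le hab
    (w := fun t : ℝ => P.ext v (z + t • e))
    (w1 := fun t : ℝ => fderiv ℝ (P.ext v) (z + t • e) e)
    (w2 := fun t : ℝ => fderiv ℝ (fderiv ℝ (P.ext v)) (z + t • e) e e)
    ((P.continuousOn_ext v).comp hcl.continuousOn fun t ht => by
      refine P.mem_Δ.mpr fun j => ?_
      have e1 := P.mem_Δ.mp haT j
      have e2 := P.mem_Δ.mp hbT j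
      rw [hLt] at e1 e2 ⊢
      rcases le_total (inner ℝ (P.normal j) e) 0 with h | h
      · nlinarith [ht.2]
      · nlinarith [ht.1])
    (fun t ht => (hasDerivAt_line isOpen_interior hv (hmap ht)).1)
    (fun t ht => (hasDerivAt_line isOpen_interior hv (hmap ht)).2)
    (h2cont.comp hcl.continuousOn hmap) (fun t ht => hconv _ (hmap ht)) (fun t _ => hv0 _)
  have hba : 0 < b - a := sub_pos.mpr hab
  have hMd : 0 ≤ 2 * M ^ P.d := by positivity
  have hind : (fun t : ℝ => (interior P.Δ).indicator (fun x => ENNReal.ofReal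
        ((∏ j, P.L j x) * fderiv ℝ (fderiv ℝ (P.ext v)) x e e)) (z + t • e)) =
      (Ioo a b).indicator (fun t : ℝ => ENNReal.ofReal ((∏ j, P.L j (z + t • e)) *
        fderiv ℝ (fderiv ℝ (P.ext v)) (z + t • e) e e)) := by
    funext t
    by_cases ht : t ∈ Ioo a b
    · rw [indicator_of_mem ht, indicator_of_mem (hmap ht)]
    · rw [indicator_of_notMem ht, indicator_of_notMem (fun h => ht ((hinterior t).mp h))]
  rw [hind, lintegral_indicator measurableSet_Ioo]
  calc ∫⁻ t in Ioo a b, ENNReal.ofReal ((∏ j, P.L j (z + t • e)) *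
        fderiv ℝ (fderiv ℝ (P.ext v)) (z + t • e) e e)
      ≤ ∫⁻ t in Ioo a b, ENNReal.ofReal (2 * M ^ P.d / (b - a)) * ENNReal.ofReal
          ((t - a) * (b - t) * fderiv ℝ (fderiv ℝ (P.ext v)) (z + t • e) e e) := by
        refine setLIntegral_mono' measurableSet_Ioo fun t ht => ?_
        rw [← ENNReal.ofReal_mul (by positivity)]
        refine ENNReal.ofReal_le_ofReal ?_
        rw [← mul_assoc]
        refine mul_le_mul_of_nonneg_right ?_ (hconv _ (hmap ht))
        rw [div_mul_eq_mul_div, le_div_iff₀ hba, mul_comm]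
        exact hφ t ht
    _ = ENNReal.ofReal (2 * M ^ P.d / (b - a)) * ∫⁻ t in Ioo a b, ENNReal.ofReal
          ((t - a) * (b - t) * fderiv ℝ (fderiv ℝ (P.ext v)) (z + t • e) e e) :=
        lintegral_const_mul' _ _ ENNReal.ofReal_ne_top
    _ ≤ ENNReal.ofReal (2 * M ^ P.d / (b - a)) * ENNReal.ofReal ((b - a) *
          (P.ext v (z + a • e) + P.ext v (z + b • e))) := by gcongr
    _ = ENNReal.ofReal (2 * M ^ P.d) * (ENNReal.ofReal (P.ext v (z + a • e)) +
          ENNReal.ofReal (P.ext v (z + b • e))) := by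
        rw [← ENNReal.ofReal_add (hv0 _) (hv0 _), ← ENNReal.ofReal_mul (by positivity),
          ← ENNReal.ofReal_mul hMd]
        congr 1
        field_simp
    _ ≤ _ := by
        gcongr
        obtain ⟨hna, hae⟩ := hparam ja a hja
        obtain ⟨hnb, hbe⟩ := hparam jb b hjb
        have hne : ja ≠ jb := by
          rintro rfl
          exact hab.ne (hae.trans hbe.symm)
        conv_lhs => rw [hae, hbe]
        rw [← Finset.sum_pair (f := fun j => ENNReal.ofReal (P.ext v
          (z + (-P.L j z / inner ℝ (P.normal j) e) • e))) hne]
        refine Finset.sum_le_sum_of_subset fun j hj => ?_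
        rw [Finset.mem_insert, Finset.mem_singleton] at hj
        rw [Finset.mem_filter]
        rcases hj with rfl | rfl
        · exact ⟨Finset.mem_univ _, hna⟩
        · exact ⟨Finset.mem_univ _, hnb⟩

theorem lintegral_facet_le {M : ℝ} (hMu : ∀ j, ‖P.normal j‖ ≤ M) (j : Fin P.d)
    (g : E m → ENNReal) :
    ∫⁻ x in P.facet j, g x ∂(Measure.euclideanHausdorffMeasure (m - 1) : Measure (E m)) ≤
      ENNReal.ofReal M * ∫⁻ x, g x ∂P.σ := by
  have hpos : 0 < ‖P.normal j‖ := norm_pos_iff.mpr (P.normal_ne_zero j)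
  have h1 : ENNReal.ofReal ‖P.normal j‖⁻¹ *
      ∫⁻ x in P.facet j, g x ∂(Measure.euclideanHausdorffMeasure (m - 1) : Measure (E m)) ≤
      ∫⁻ x, g x ∂P.σ := by
    rw [← smul_eq_mul, ← lintegral_smul_measure]
    exact lintegral_mono' (Measure.le_sum (fun j : Fin P.d =>
      ENNReal.ofReal ‖P.normal j‖⁻¹ •
        (Measure.euclideanHausdorffMeasure (m - 1) : Measure (E m)).restrict (P.facet j)) j) le_rfl
  calc _ = ENNReal.ofReal ‖P.normal j‖ * (ENNReal.ofReal ‖P.normal j‖⁻¹ *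
      ∫⁻ x in P.facet j, g x ∂(Measure.euclideanHausdorffMeasure (m - 1) : Measure (E m))) := by
        rw [← mul_assoc, ← ENNReal.ofReal_mul hpos.le, mul_inv_cancel₀ hpos.ne',
          ENNReal.ofReal_one, one_mul]
    _ ≤ _ := mul_le_mul' (ENNReal.ofReal_le_ofReal (hMu j)) h1

/-- The hyperplane `L_j = 0` is a graph over the coordinate hyperplane `x_i = 0` whenever it is
transverse to `e_i`, and projecting along `e_i` does not increase area. -/
theorem lintegral_graph_le {n : ℕ} (P : LabelledPolytope (n + 1)) (i : Fin (n + 1)) (j : Fin P.d)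
    (hj : inner ℝ (P.normal j) (EuclideanSpace.single i (1 : ℝ)) ≠ 0) (v : C(P.Δ, ℝ)) :
    ∫⁻ y : E n, ENNReal.ofReal (P.ext v (insertCoord i 0 y +
        (-P.L j (insertCoord i 0 y) / inner ℝ (P.normal j) (EuclideanSpace.single i (1 : ℝ))) •
          EuclideanSpace.single i (1 : ℝ))) ≤
      ∫⁻ x in P.facet j, ENNReal.ofReal (P.ext v x)
        ∂(Measure.euclideanHausdorffMeasure n : Measure (E (n + 1))) := by
  set e : E (n + 1) := EuclideanSpace.single i (1 : ℝ) with he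
  let γ : E n → E (n + 1) := fun y => insertCoord i 0 y +
    (-P.L j (insertCoord i 0 y) / inner ℝ (P.normal j) e) • e
  have hγc : Continuous γ := by
    have h1 : Continuous fun y : E n => insertCoord i 0 y :=
      (continuous_insertCoord i).comp (by fun_prop : Continuous fun y : E n => ((0 : ℝ), y))
    have h2 := (P.continuous_L j).comp h1
    simp only [Function.comp_def] at h2
    fun_prop
  have hγ : AntilipschitzWith 1 γ := AntilipschitzWith.of_le_mul_dist fun y y' => by
    simp only [γ, NNReal.coe_one, one_mul, he]
    rw [← insertCoord_eq, ← insertCoord_eq]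
    exact dist_le_dist_insertCoord _ _ _ _ _
  have hm : Measurable fun x => ENNReal.ofReal (P.ext v x) :=
    ENNReal.measurable_ofReal.comp (P.measurable_ext v)
  have hL0 : ∀ y, P.L j (γ y) = 0 := fun y => by
    simp only [γ]
    rw [P.L_add, real_inner_smul_right]
    field_simp
    ring
  have hsupp : ∀ y, ENNReal.ofReal (P.ext v (γ y)) =
      (P.facet j).indicator (fun x => ENNReal.ofReal (P.ext v x)) (γ y) := fun y => by
    by_cases hy : γ y ∈ P.Δ
    · rw [indicator_of_mem (show γ y ∈ P.facet j from ⟨hy, hL0 y⟩)]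
    · rw [indicator_of_notMem (fun h => hy h.1), P.ext_apply_of_notMem v hy, ENNReal.ofReal_zero]
  have hfm := (P.isCompact_facet j).measurableSet
  calc ∫⁻ y : E n, ENNReal.ofReal (P.ext v (γ y))
      = ∫⁻ x, (P.facet j).indicator (fun x => ENNReal.ofReal (P.ext v x)) x
          ∂((volume : Measure (E n)).map γ) := by
        rw [lintegral_map (hm.indicator hfm) hγc.measurable]
        exact lintegral_congr hsupp
    _ ≤ _ := by
        rw [← lintegral_indicator hfm]
        exact lintegral_mono' (map_volume_le_of_antilipschitz hγc.measurable hγ) le_rfl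

/-- The degenerate weight `∏ L_j` makes the Hessian of a nonnegative convex function integrable,
with a bound by its boundary values alone. -/
theorem exists_lintegral_trace_hess_le : ∃ K : ℝ, 0 ≤ K ∧ ∀ v : C(P.Δ, ℝ),
    ContDiffOn ℝ ∞ (P.ext v) (interior P.Δ) → (∀ x, 0 ≤ P.ext v x) →
    (∀ x ∈ interior P.Δ, (hess (P.ext v) x).PosSemidef) →
    ∫⁻ x in interior P.Δ, ENNReal.ofReal ((∏ j, P.L j x) * (hess (P.ext v) x).trace) ≤
      ENNReal.ofReal K * ∫⁻ x, ENNReal.ofReal (P.ext v x) ∂P.σ := by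
  rcases m with _ | n
  · exact ⟨0, le_rfl, fun v _ _ _ => by simp [Matrix.trace]⟩
  obtain ⟨M, hM1, hM, hMu⟩ := P.exists_bound
  have hM0 : 0 ≤ M := by linarith
  refine ⟨(n + 1) * (2 * M ^ P.d * (P.d * M)), by positivity, fun v hv hv0 hpsd => ?_⟩
  set I := ∫⁻ x, ENNReal.ofReal (P.ext v x) ∂P.σ with hI
  let F : Fin (n + 1) → E (n + 1) → ENNReal := fun i =>
    (interior P.Δ).indicator fun x => ENNReal.ofReal ((∏ j, P.L j x) *
      fderiv ℝ (fderiv ℝ (P.ext v)) x (EuclideanSpace.single i 1) (EuclideanSpace.single i 1))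
  have hFm : ∀ i, Measurable (F i) := fun i => by
    refine Measurable.indicator ?_ isOpen_interior.measurableSet
    refine ENNReal.measurable_ofReal.comp (Measurable.mul ?_ ?_)
    · exact (continuous_finsetProd _ fun j _ => P.continuous_L j).measurable
    · exact ((ContinuousLinearMap.apply ℝ ℝ (EuclideanSpace.single i (1 : ℝ) :
        E (n + 1))).continuous.measurable).comp
        (measurable_fderiv_apply_const ℝ (fderiv ℝ (P.ext v)) (EuclideanSpace.single i 1))
  have hdiag : ∀ i, ∀ x ∈ interior P.Δ, 0 ≤ fderiv ℝ (fderiv ℝ (P.ext v)) x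
      (EuclideanSpace.single i 1) (EuclideanSpace.single i 1) := fun i x hx =>
    (hpsd x hx).diag_nonneg (i := i)
  have hFi : ∀ i, ∫⁻ x, F i x ≤ ENNReal.ofReal (2 * M ^ P.d * (P.d * M)) * I := by
    intro i
    rw [lintegral_eq_lintegral_insertCoord i (hFm i)]
    calc ∫⁻ y : E n, ∫⁻ t : ℝ, F i (insertCoord i t y)
        ≤ ∫⁻ y : E n, ENNReal.ofReal (2 * M ^ P.d) *
          ∑ j with inner ℝ (P.normal j) (EuclideanSpace.single i (1 : ℝ)) ≠ 0,
            ENNReal.ofReal (P.ext v (insertCoord i 0 y + (-P.L j (insertCoord i 0 y) /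
              inner ℝ (P.normal j) (EuclideanSpace.single i (1 : ℝ))) •
                EuclideanSpace.single i (1 : ℝ))) := by
          refine lintegral_mono fun y => ?_
          refine (lintegral_congr fun t => by rw [insertCoord_eq i t y]).trans_le ?_
          exact P.lintegral_line_le hM1 hM hMu hv hv0 (by simp) (hdiag i) _
      _ = ENNReal.ofReal (2 * M ^ P.d) *
          ∑ j with inner ℝ (P.normal j) (EuclideanSpace.single i (1 : ℝ)) ≠ 0,
            ∫⁻ y : E n, ENNReal.ofReal (P.ext v (insertCoord i 0 y +
              (-P.L j (insertCoord i 0 y) /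
              inner ℝ (P.normal j) (EuclideanSpace.single i (1 : ℝ))) •
                EuclideanSpace.single i (1 : ℝ))) := by
          rw [lintegral_const_mul' _ _ ENNReal.ofReal_ne_top, lintegral_finsetSum]
          intro j _
          refine ENNReal.measurable_ofReal.comp ((P.measurable_ext v).comp ?_)
          have h1 : Continuous fun y : E n => insertCoord i 0 y :=
            (continuous_insertCoord i).comp (by fun_prop : Continuous fun y : E n => ((0 : ℝ), y))
          have h2 := (P.continuous_L j).comp h1
          simp only [Function.comp_def] at h2
          exact Continuous.measurable (by fun_prop)
      _ ≤ ENNReal.ofReal (2 * M ^ P.d) *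
          ∑ j with inner ℝ (P.normal j) (EuclideanSpace.single i (1 : ℝ)) ≠ 0,
            ENNReal.ofReal M * I := by
          gcongr with j hj
          rw [Finset.mem_filter] at hj
          exact (lintegral_graph_le P i j hj.2 v).trans (P.lintegral_facet_le hMu j _)
      _ ≤ ENNReal.ofReal (2 * M ^ P.d) * ∑ _j : Fin P.d, ENNReal.ofReal M * I := by
          gcongr
          exact Finset.filter_subset _ _
      _ = _ := by
          rw [Finset.sum_const, Finset.card_univ, Fintype.card_fin, nsmul_eq_mul,
            ENNReal.ofReal_mul (p := 2 * M ^ P.d) (by positivity),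
            ENNReal.ofReal_mul (p := (P.d : ℝ)) (by positivity), ENNReal.ofReal_natCast]
          ring
  calc ∫⁻ x in interior P.Δ, ENNReal.ofReal ((∏ j, P.L j x) * (hess (P.ext v) x).trace)
      = ∫⁻ x, ∑ i, F i x := by
        rw [← lintegral_indicator isOpen_interior.measurableSet]
        refine lintegral_congr fun x => ?_
        by_cases hx : x ∈ interior P.Δ
        · simp only [F, indicator_of_mem hx]
          rw [← ENNReal.ofReal_sum_of_nonneg, ← Finset.mul_sum]
          · rfl
          · exact fun i _ => mul_nonneg (Finset.prod_nonneg fun j _ =>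
              (P.mem_interior_iff.mp hx j).le) (hdiag i x hx)
        · simp [F, indicator_of_notMem hx]
    _ = ∑ i, ∫⁻ x, F i x := lintegral_finsetSum _ fun i _ => hFm i
    _ ≤ ∑ _i : Fin (n + 1), ENNReal.ofReal (2 * M ^ P.d * (P.d * M)) * I :=
        Finset.sum_le_sum fun i _ => hFi i
    _ = _ := by
        rw [Finset.sum_const, Finset.card_univ, Fintype.card_fin, nsmul_eq_mul, ← mul_assoc,
          ENNReal.ofReal_mul (by positivity : (0 : ℝ) ≤ n + 1)]
        congr 2
        rw [← Nat.cast_succ, ENNReal.ofReal_natCast]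

/-! ### The canonical potential -/

/-- The matrix whose rows are the normals. -/
def normalMatrix : Matrix (Fin P.d) (Fin m) ℝ := Matrix.of fun j i => P.normal j i

theorem normalMatrix_mulVec (v : Fin m → ℝ) (j : Fin P.d) :
    P.normalMatrix.mulVec v j = inner ℝ (P.normal j) (WithLp.toLp 2 v : E m) := by
  simp [normalMatrix, Matrix.mulVec, dotProduct, PiLp.inner_apply, mul_comm]

theorem injective_normalMatrix_mulVec : Function.Injective P.normalMatrix.mulVec := by
  intro a b hab
  have h : (WithLp.toLp 2 (a - b) : E m) = 0 := P.eq_zero_of_inner_normal_eq_zero fun j => by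
    rw [← P.normalMatrix_mulVec, Matrix.mulVec_sub, hab, sub_self, Pi.zero_apply]
  rw [WithLp.toLp_eq_zero] at h
  exact sub_eq_zero.mp h

theorem hasFDerivAt_L (j : Fin P.d) (x : E m) :
    HasFDerivAt (P.L j) (innerSL ℝ (P.normal j)) x :=
  (innerSL ℝ (P.normal j)).hasFDerivAt.add_const (P.const j)

theorem contDiff_L (j : Fin P.d) : ContDiff ℝ ∞ (P.L j) :=
  (innerSL ℝ (P.normal j)).contDiff.add contDiff_const

theorem hasFDerivAt_canonical {x : E m} (hx : x ∈ interior P.Δ) :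
    HasFDerivAt P.canonical
      ((1 / 2 : ℝ) • ∑ j, (Real.log (P.L j x) + 1) • innerSL ℝ (P.normal j)) x := by
  refine HasFDerivAt.const_mul (HasFDerivAt.fun_sum fun j _ => ?_) _
  exact (Real.hasDerivAt_mul_log (P.mem_interior_iff.mp hx j).ne').comp_hasFDerivAt x
    (P.hasFDerivAt_L j x)

theorem hasFDerivAt_fderiv_canonical {x : E m} (hx : x ∈ interior P.Δ) :
    HasFDerivAt (fderiv ℝ P.canonical) ((1 / 2 : ℝ) • ∑ j,
      ((P.L j x)⁻¹ • innerSL ℝ (P.normal j)).smulRight (innerSL ℝ (P.normal j))) x := by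
  have h1 : HasFDerivAt (fun y => (1 / 2 : ℝ) • ∑ j, (Real.log (P.L j y) + 1) •
      innerSL ℝ (P.normal j)) ((1 / 2 : ℝ) • ∑ j,
      ((P.L j x)⁻¹ • innerSL ℝ (P.normal j)).smulRight (innerSL ℝ (P.normal j))) x := by
    refine HasFDerivAt.fun_const_smul (HasFDerivAt.fun_sum fun j _ => ?_) _
    refine HasFDerivAt.smul_const (c' := (P.L j x)⁻¹ • innerSL ℝ (P.normal j)) ?_
      (innerSL ℝ (P.normal j))
    exact ((Real.hasDerivAt_log (P.mem_interior_iff.mp hx j).ne').comp_hasFDerivAt x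
      (P.hasFDerivAt_L j x)).add_const 1
  refine h1.congr_of_eventuallyEq ?_
  filter_upwards [isOpen_interior.mem_nhds hx] with y hy
  exact (P.hasFDerivAt_canonical hy).fderiv

theorem hess_canonical {x : E m} (hx : x ∈ interior P.Δ) :
    hess P.canonical x = (1 / 2 : ℝ) •
      (P.normalMatrix.transpose * Matrix.diagonal (fun j => (P.L j x)⁻¹) * P.normalMatrix) := by
  ext i k
  simp only [hess, Matrix.of_apply, (P.hasFDerivAt_fderiv_canonical hx).fderiv]
  simp only [_root_.smul_apply, _root_.sum_apply, ContinuousLinearMap.smulRight_apply,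
    innerSL_apply_apply, EuclideanSpace.inner_single_right, smul_eq_mul, Matrix.smul_apply,
    Matrix.mul_apply (M := _ * _), Matrix.mul_diagonal, Matrix.transpose_apply, normalMatrix,
    Matrix.of_apply, conj_trivial, one_mul]
  congr 1
  exact Finset.sum_congr rfl fun j _ => by ring

theorem posDef_conj_diagonal {w : Fin P.d → ℝ} (hw : ∀ j, 0 < w j) :
    ((1 / 2 : ℝ) • (P.normalMatrix.transpose * Matrix.diagonal w * P.normalMatrix)).PosDef := by
  refine Matrix.PosDef.smul ?_ (by norm_num)
  have := (Matrix.PosDef.diagonal hw).conjTranspose_mul_mul_same (B := P.normalMatrix)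
    P.injective_normalMatrix_mulVec
  rwa [Matrix.conjTranspose_eq_transpose_of_trivial] at this

theorem posDef_hess_canonical {x : E m} (hx : x ∈ interior P.Δ) :
    (hess P.canonical x).PosDef := by
  rw [P.hess_canonical hx]
  exact P.posDef_conj_diagonal fun j => inv_pos.mpr (P.mem_interior_iff.mp hx j)

theorem exists_le_log_det_hess_canonical :
    ∃ c : ℝ, ∀ x ∈ interior P.Δ, c ≤ Real.log (hess P.canonical x).det := by
  obtain ⟨M, hM1, hM, -⟩ := P.exists_bound
  have hA := P.posDef_conj_diagonal (w := fun _ => M⁻¹) fun _ => by positivity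
  refine ⟨_, fun x hx => Real.log_le_log hA.det_pos ?_⟩
  have hpos := P.mem_interior_iff.mp hx
  have hB : ((1 / 2 : ℝ) • (P.normalMatrix.transpose *
      Matrix.diagonal (fun j => (P.L j x)⁻¹ - M⁻¹) * P.normalMatrix)).PosSemidef := by
    refine Matrix.PosSemidef.smul ?_ (by norm_num)
    have h1 : (Matrix.diagonal (fun j => (P.L j x)⁻¹ - M⁻¹)).PosSemidef :=
      Matrix.PosSemidef.diagonal fun j => sub_nonneg.mpr
        (inv_anti₀ (hpos j) (hM j x (interior_subset hx)))
    have := h1.conjTranspose_mul_mul_same P.normalMatrix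
    rwa [Matrix.conjTranspose_eq_transpose_of_trivial] at this
  refine (det_le_det_add hA hB).trans_eq ?_
  rw [P.hess_canonical hx, ← smul_add, ← Matrix.add_mul, ← Matrix.mul_add, Matrix.diagonal_add]
  simp

theorem convexOn_canonical : ConvexOn ℝ P.Δ P.canonical := by
  have h : ∀ j, ConvexOn ℝ P.Δ fun x => P.L j x * Real.log (P.L j x) := by
    intro j
    refine ⟨P.convex_Δ, fun x hx y hy a b ha hb hab => ?_⟩
    simp only [P.L_combo j hab]
    exact Real.convexOn_mul_log.2 (P.mem_Δ.mp hx j) (P.mem_Δ.mp hy j) ha hb hab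
  refine ⟨P.convex_Δ, fun x hx y hy a b ha hb hab => ?_⟩
  have h2 := Finset.sum_le_sum fun j (_ : j ∈ Finset.univ) => (h j).2 hx hy ha hb hab
  simp only [canonical, smul_eq_mul] at h2 ⊢
  rw [Finset.sum_add_distrib, ← Finset.mul_sum, ← Finset.mul_sum] at h2
  linarith

theorem continuous_canonical : Continuous P.canonical :=
  continuous_const.mul (continuous_finsetSum _ fun j _ =>
    Real.continuous_mul_log.comp (P.continuous_L j))

theorem contDiffOn_canonical : ContDiffOn ℝ ∞ P.canonical (interior P.Δ) :=
  contDiffOn_const.mul (ContDiffOn.sum fun j _ => (P.contDiff_L j).contDiffOn.mul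
    ((P.contDiff_L j).contDiffOn.log fun _ hx => (P.mem_interior_iff.mp hx j).ne'))

/-! ### Smoothness of the inverse Hessian up to the boundary -/

/-- The block matrix `[[diag L, U], [-Uᵀ, 0]]`, where `U` has the normals as rows. Its entries are
affine-linear, it is invertible on all of `Δ`, and by Schur complements the lower right block of its
inverse is `(Uᵀ diag(L)⁻¹ U)⁻¹`, half of the inverse Hessian of the canonical potential. -/
def blockMatrix (x : E m) : Matrix (Fin P.d ⊕ Fin m) (Fin P.d ⊕ Fin m) ℝ :=
  Matrix.fromBlocks (Matrix.diagonal fun j => P.L j x) P.normalMatrix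
    (-P.normalMatrix.transpose) 0

open Matrix in
theorem blockMatrix_mulVec (x : E m) (a : Fin P.d → ℝ) (b : Fin m → ℝ) :
    P.blockMatrix x *ᵥ Sum.elim a b = Sum.elim
      (diagonal (fun j => P.L j x) *ᵥ a + P.normalMatrix *ᵥ b)
      (-(P.normalMatrixᵀ *ᵥ a)) := by
  rw [blockMatrix, fromBlocks_mulVec]
  simp [neg_mulVec]

open Matrix in
theorem det_blockMatrix_ne_zero {x : E m} (hx : x ∈ P.Δ) : (P.blockMatrix x).det ≠ 0 := by
  intro h0
  obtain ⟨w, hw, hw0⟩ := exists_mulVec_eq_zero_iff.mpr h0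
  obtain ⟨a, b, rfl⟩ : ∃ a b, w = Sum.elim a b := ⟨w ∘ Sum.inl, w ∘ Sum.inr, by simp⟩
  rw [P.blockMatrix_mulVec] at hw0
  have h1 : diagonal (fun j => P.L j x) *ᵥ a + P.normalMatrix *ᵥ b = 0 := by
    funext j; exact congrFun hw0 (Sum.inl j)
  have h2 : P.normalMatrixᵀ *ᵥ a = 0 := by
    funext i; simpa using congrFun hw0 (Sum.inr i)
  have h3 : a ⬝ᵥ (diagonal (fun j => P.L j x) *ᵥ a) = 0 := by
    have h4 : a ⬝ᵥ (P.normalMatrix *ᵥ b) = 0 := by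
      rw [dotProduct_mulVec, ← mulVec_transpose, h2, zero_dotProduct]
    have h5 := congrArg (a ⬝ᵥ ·) h1
    simpa [dotProduct_add, h4] using h5
  have h4 : ∀ j, P.L j x * a j = 0 := by
    have h5 : ∑ j, P.L j x * (a j * a j) = 0 := by
      rw [← h3]
      simp only [dotProduct, mulVec_diagonal]
      exact Finset.sum_congr rfl fun j _ => by ring
    rw [Finset.sum_eq_zero_iff_of_nonneg
      fun j _ => mul_nonneg (P.mem_Δ.mp hx j) (mul_self_nonneg _)] at h5
    intro j
    have := h5 j (Finset.mem_univ j)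
    rcases mul_eq_zero.mp this with h | h
    · rw [h, zero_mul]
    · rw [mul_self_eq_zero.mp h, mul_zero]
  have ha : a = 0 := by
    have hli := Fintype.linearIndependent_iff.mp (P.linearIndependent_active hx)
      (fun j => a j.1) ?_
    · funext j
      by_cases hj : P.L j x = 0
      · exact hli ⟨j, hj⟩
      · exact (mul_eq_zero.mp (h4 j)).resolve_left hj
    · have hsum : ∑ j, a j • P.normal j = 0 := by
        ext i
        have := congrFun h2 i
        simpa [mulVec, dotProduct, normalMatrix, mul_comm] using this
      rw [← hsum]
      refine Fintype.sum_of_injective Subtype.val Subtype.val_injective _ _ (fun j hj => ?_)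
        fun _ => rfl
      have hj' : P.L j x ≠ 0 := fun h => hj ⟨⟨j, h⟩, rfl⟩
      rw [(mul_eq_zero.mp (h4 j)).resolve_left hj', zero_smul]
  subst ha
  have hb : b = 0 := P.injective_normalMatrix_mulVec (by simpa using h1)
  subst hb
  exact hw (by simp)

/-- The lower right block of the inverse of the block matrix. -/
def inverseBlock (x : E m) : Matrix (Fin m) (Fin m) ℝ := (P.blockMatrix x)⁻¹.toBlocks₂₂

open Matrix in
theorem inverseBlock_nonneg {x : E m} (hx : x ∈ P.Δ) (c : Fin m → ℝ) :
    0 ≤ c ⬝ᵥ (P.inverseBlock x *ᵥ c) := by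
  have hu : IsUnit (P.blockMatrix x).det := isUnit_iff_ne_zero.mpr (P.det_blockMatrix_ne_zero hx)
  obtain ⟨a, b, hab⟩ : ∃ (a : Fin P.d → ℝ) (b : Fin m → ℝ),
      (P.blockMatrix x)⁻¹ *ᵥ Sum.elim 0 c = Sum.elim a b := ⟨_, _, (Sum.elim_comp_inl_inr _).symm⟩
  have hb : P.inverseBlock x *ᵥ c = b := by
    rw [← fromBlocks_toBlocks (P.blockMatrix x)⁻¹, fromBlocks_mulVec] at hab
    funext i
    simpa [inverseBlock] using congrFun hab (Sum.inr i)
  have h1 : P.blockMatrix x *ᵥ Sum.elim a b = Sum.elim (0 : Fin P.d → ℝ) c := by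
    rw [← hab, mulVec_mulVec, mul_nonsing_inv _ hu, one_mulVec]
  rw [P.blockMatrix_mulVec] at h1
  have h2 : diagonal (fun j => P.L j x) *ᵥ a + P.normalMatrix *ᵥ b = 0 := by
    funext j; exact congrFun h1 (Sum.inl j)
  have h3 : -(P.normalMatrixᵀ *ᵥ a) = c := by
    funext i; exact congrFun h1 (Sum.inr i)
  rw [hb, ← h3, neg_dotProduct, mulVec_transpose, ← dotProduct_mulVec,
    eq_neg_of_add_eq_zero_right h2, dotProduct_neg, neg_neg]
  simp only [dotProduct, mulVec_diagonal]
  exact Finset.sum_nonneg fun j _ => by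
    have := mul_nonneg (P.mem_Δ.mp hx j) (mul_self_nonneg (a j))
    linarith

open Matrix in
theorem inv_hess_canonical {x : E m} (hx : x ∈ interior P.Δ) :
    (hess P.canonical x)⁻¹ = (2 : ℝ) • P.inverseBlock x := by
  have hu : IsUnit (P.blockMatrix x).det :=
    isUnit_iff_ne_zero.mpr (P.det_blockMatrix_ne_zero (interior_subset hx))
  have h := mul_nonsing_inv _ hu
  rw [← fromBlocks_toBlocks (P.blockMatrix x)⁻¹, blockMatrix, fromBlocks_multiply,
    ← fromBlocks_one, fromBlocks_inj, ← blockMatrix] at h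
  obtain ⟨-, h12, -, h22⟩ := h
  rw [Matrix.zero_mul, add_zero] at h22
  have hd : diagonal (fun j => (P.L j x)⁻¹) * diagonal (fun j => P.L j x) = 1 := by
    rw [diagonal_mul_diagonal, ← diagonal_one]
    congr 1
    funext j
    exact inv_mul_cancel₀ (P.mem_interior_iff.mp hx j).ne'
  have hY : (P.blockMatrix x)⁻¹.toBlocks₁₂ =
      -(diagonal (fun j => (P.L j x)⁻¹) * (P.normalMatrix * P.inverseBlock x)) := by
    have := congrArg (diagonal (fun j => (P.L j x)⁻¹) * ·) h12
    simp only [Matrix.mul_add, ← Matrix.mul_assoc, hd, Matrix.one_mul, Matrix.mul_zero] at this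
    rw [Matrix.mul_assoc] at this
    exact eq_neg_of_add_eq_zero_left this
  refine inv_eq_right_inv ?_
  rw [P.hess_canonical hx, smul_mul_smul_comm, show (1 / 2 : ℝ) * 2 = 1 by norm_num, one_smul,
    ← h22, hY]
  simp only [Matrix.neg_mul, Matrix.mul_neg, neg_neg, Matrix.mul_assoc]

end LabelledPolytope

theorem contDiff_det {V ι : Type*} [NormedAddCommGroup V] [NormedSpace ℝ V] [Fintype ι]
    [DecidableEq ι] {A : V → Matrix ι ι ℝ} (hA : ∀ i j, ContDiff ℝ ∞ fun x => A x i j) :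
    ContDiff ℝ ∞ fun x => (A x).det := by
  simp only [Matrix.det_apply]
  exact ContDiff.sum fun σ _ => (contDiff_prod fun i _ => hA _ _).const_smul _

theorem contDiff_adjugate {V ι : Type*} [NormedAddCommGroup V] [NormedSpace ℝ V] [Fintype ι]
    [DecidableEq ι] {A : V → Matrix ι ι ℝ} (hA : ∀ i j, ContDiff ℝ ∞ fun x => A x i j) (i j : ι) :
    ContDiff ℝ ∞ fun x => (A x).adjugate i j := by
  simp only [Matrix.adjugate_apply]
  refine contDiff_det fun k l => ?_
  by_cases hk : k = j
  · subst hk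
    simpa using contDiff_const
  · simpa [Matrix.updateRow_ne hk] using hA k l

/-- The reciprocal of a smooth function without zeros on a closed set extends smoothly from that
set: write `1 / D = D / D²` and add to `D²` a nonnegative smooth function with zero set `s`. -/
theorem exists_contDiff_eq_inv {V : Type*} [NormedAddCommGroup V] [NormedSpace ℝ V]
    [FiniteDimensional ℝ V] {s : Set V} (hs : IsClosed s) {D : V → ℝ} (hD : ContDiff ℝ ∞ D)
    (hD0 : ∀ x ∈ s, D x ≠ 0) : ∃ ρ : V → ℝ, ContDiff ℝ ∞ ρ ∧ ∀ x ∈ s, ρ x = (D x)⁻¹ := by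
  obtain ⟨f, hf, hfs, hfr⟩ := hs.isOpen_compl.exists_contDiff_support_eq (n := ⊤)
  have hf0 : ∀ x, 0 ≤ f x := fun x => (hfr (mem_range_self x)).1
  have hne : ∀ x, D x ^ 2 + f x ≠ 0 := fun x => by
    by_cases hx : x ∈ s
    · have := hD0 x hx
      have := hf0 x
      positivity
    · have h1 : f x ≠ 0 := by
        rw [← Function.mem_support, hf]
        exact hx
      have := (hf0 x).lt_of_ne' h1
      positivity
  refine ⟨fun x => D x / (D x ^ 2 + f x), hD.div ((hD.pow 2).add hfs) hne, fun x hx => ?_⟩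
  have h1 : f x = 0 := by
    rw [← Function.notMem_support, hf]
    exact fun h => h hx
  have := hD0 x hx
  simp only [h1, add_zero]
  field_simp

namespace LabelledPolytope

variable {m : ℕ} (P : LabelledPolytope m)

/-- The inverse Hessian of the canonical potential is smooth up to the boundary of `Δ`. -/
theorem exists_contDiff_eq_inverseBlock : ∃ W : E m → Matrix (Fin m) (Fin m) ℝ,
    (∀ i j, ContDiff ℝ ∞ fun x => W x i j) ∧ ∀ x ∈ P.Δ, W x = P.inverseBlock x := by
  have hB : ∀ i j, ContDiff ℝ ∞ fun x => P.blockMatrix x i j := by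
    rintro (i | i) (j | j)
    · by_cases hij : i = j
      · subst hij
        simpa [blockMatrix] using P.contDiff_L i
      · simpa [blockMatrix, hij] using contDiff_const
    all_goals exact contDiff_const
  obtain ⟨ρ, hρ, hρ'⟩ := exists_contDiff_eq_inv P.isClosed_Δ (contDiff_det hB)
    fun x hx => P.det_blockMatrix_ne_zero hx
  refine ⟨fun x => ρ x • (P.blockMatrix x).adjugate.toBlocks₂₂, fun i j => ?_, fun x hx => ?_⟩
  · exact hρ.mul (contDiff_adjugate hB (Sum.inr i) (Sum.inr j))
  · rw [inverseBlock, Matrix.inv_def, Ring.inverse_eq_inv', ← hρ' x hx]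
    rfl

/-! ### Hessians of convex functions -/

open Matrix in
theorem dotProduct_hess_mulVec (f : E m → ℝ) (x : E m) (c : Fin m → ℝ) :
    c ⬝ᵥ (hess f x *ᵥ c) =
      fderiv ℝ (fderiv ℝ f) x (WithLp.toLp 2 c : E m) (WithLp.toLp 2 c : E m) := by
  have h : (WithLp.toLp 2 c : E m) = ∑ i, c i • EuclideanSpace.single i (1 : ℝ) := by
    ext k
    simp [Pi.single_apply]
  rw [h]
  simp only [map_sum, map_smul, _root_.sum_apply, _root_.smul_apply, smul_eq_mul,
    dotProduct, mulVec, hess, Matrix.of_apply, Finset.mul_sum]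
  rw [Finset.sum_comm]
  exact Finset.sum_congr rfl fun i _ => Finset.sum_congr rfl fun j _ => by ring

theorem posSemidef_hess {F : E m → ℝ} (hF : ContDiff ℝ ∞ F) (hc : ConvexOn ℝ univ F) (x : E m) :
    (hess F x).PosSemidef := by
  refine Matrix.PosSemidef.of_dotProduct_mulVec_nonneg ?_ fun c => ?_
  · have hsymm : IsSymmSndFDerivAt ℝ F x := hF.contDiffAt.isSymmSndFDerivAt
      (by simpa using WithTop.coe_le_coe.mpr (le_top : (2 : ℕ∞) ≤ ⊤))
    ext i k
    simp only [hess, Matrix.conjTranspose_apply, Matrix.of_apply, star_trivial]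
    exact hsymm _ _
  · rw [star_trivial, dotProduct_hess_mulVec]
    set e : E m := WithLp.toLp 2 c
    have hd := fun t : ℝ => hasDerivAt_line isOpen_univ hF.contDiffOn (mem_univ (x + t • e))
    have hconv : ConvexOn ℝ univ fun t : ℝ => F (x + t • e) := by
      refine ⟨convex_univ, fun s _ t _ a b ha hb hab => ?_⟩
      have h1 := hc.2 (mem_univ (x + s • e)) (mem_univ (x + t • e)) ha hb hab
      have h2 : x + (a • s + b • t) • e = a • (x + s • e) + b • (x + t • e) := by
        have : x = (a + b) • x := by rw [hab, one_smul]
        conv_lhs => rw [this]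
        simp only [smul_eq_mul]
        module
      simp only [h2]
      exact h1
    have hmono := hconv.monotoneOn_deriv fun t _ => (hd t).1.differentiableAt
    have hderiv : deriv (fun t : ℝ => F (x + t • e)) = fun t => fderiv ℝ F (x + t • e) e :=
      funext fun t => (hd t).1.deriv
    rw [hderiv, monotoneOn_univ] at hmono
    have h0 := (hd 0).2
    have := hmono.deriv_nonneg (x := 0)
    rw [h0.deriv] at this
    simpa using this

theorem contDiff_hess_apply {F : E m → ℝ} (hF : ContDiff ℝ ∞ F) (i j : Fin m) :
    ContDiff ℝ ∞ fun x => hess F x i j := by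
  have h1 : ContDiff ℝ ∞ (fderiv ℝ F) := hF.fderiv_right (by simp)
  have h2 : ContDiff ℝ ∞ (fderiv ℝ (fderiv ℝ F)) := h1.fderiv_right (by simp)
  exact (h2.clm_apply contDiff_const).clm_apply contDiff_const

end LabelledPolytope

/-! ### Smooth convex approximation -/

/-- The smooth maximum `κ⁻¹ log ∑ exp (κ a_i)`. -/
def softMax {V ι : Type*} (t : Finset ι) (κ : ℝ) (a : ι → V → ℝ) (x : V) : ℝ :=
  κ⁻¹ * Real.log (∑ i ∈ t, Real.exp (κ * a i x))

section SoftMax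

variable {V ι : Type*} {t : Finset ι} {κ : ℝ} {a : ι → V → ℝ}

theorem sum_exp_pos (ht : t.Nonempty) (x : V) : 0 < ∑ i ∈ t, Real.exp (κ * a i x) :=
  Finset.sum_pos (fun _ _ => Real.exp_pos _) ht

theorem le_softMax (hκ : 0 < κ) {i : ι} (hi : i ∈ t) (x : V) : a i x ≤ softMax t κ a x := by
  have h := Real.log_le_log (Real.exp_pos _) (Finset.single_le_sum
    (f := fun i => Real.exp (κ * a i x)) (fun _ _ => (Real.exp_pos _).le) hi)
  rw [Real.log_exp] at h
  rw [softMax, ← div_eq_inv_mul, le_div_iff₀ hκ, mul_comm]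
  exact h

theorem softMax_le (hκ : 0 < κ) (ht : t.Nonempty) {x : V} {c : ℝ} (hc : ∀ i ∈ t, a i x ≤ c) :
    softMax t κ a x ≤ c + κ⁻¹ * Real.log t.card := by
  have h1 : ∑ i ∈ t, Real.exp (κ * a i x) ≤ t.card * Real.exp (κ * c) := by
    rw [← nsmul_eq_mul]
    refine Finset.sum_le_card_nsmul _ _ _ fun i hi => Real.exp_le_exp.mpr ?_
    exact mul_le_mul_of_nonneg_left (hc i hi) hκ.le
  have h2 := Real.log_le_log (sum_exp_pos ht x) h1
  have hcard : (t.card : ℝ) ≠ 0 := by exact_mod_cast ht.card_pos.ne'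
  rw [Real.log_mul hcard (Real.exp_pos _).ne', Real.log_exp] at h2
  rw [softMax]
  calc κ⁻¹ * Real.log (∑ i ∈ t, Real.exp (κ * a i x))
      ≤ κ⁻¹ * (Real.log t.card + κ * c) := mul_le_mul_of_nonneg_left h2 (by positivity)
    _ = c + κ⁻¹ * Real.log t.card := by field_simp; ring

theorem contDiff_softMax [NormedAddCommGroup V] [NormedSpace ℝ V] (ht : t.Nonempty)
    (ha : ∀ i, ContDiff ℝ ∞ (a i)) : ContDiff ℝ ∞ (softMax t κ a) :=
  contDiff_const.mul ((ContDiff.sum fun i _ => (contDiff_const.mul (ha i)).exp).log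
    fun x => (sum_exp_pos ht x).ne')

/-- Log-sum-exp is convex: after normalizing both exponential sums to `1` this is the convexity of
`exp`, summed over the index. -/
theorem convexOn_softMax [AddCommGroup V] [Module ℝ V] (hκ : 0 < κ) (ht : t.Nonempty)
    (ha : ∀ i, ConvexOn ℝ univ (a i)) : ConvexOn ℝ univ (softMax t κ a) := by
  refine ⟨convex_univ, fun x _ y _ α β hα hβ hαβ => ?_⟩
  set p := Real.log (∑ i ∈ t, Real.exp (κ * a i x)) with hp
  set q := Real.log (∑ i ∈ t, Real.exp (κ * a i y)) with hq
  have hnorm : ∀ z, ∑ i ∈ t, Real.exp (κ * a i z -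
      Real.log (∑ i ∈ t, Real.exp (κ * a i z))) = 1 := fun z => by
    simp only [Real.exp_sub, Real.exp_log (sum_exp_pos ht z)]
    rw [← Finset.sum_div, div_self (sum_exp_pos ht z).ne']
  have h1 : ∑ i ∈ t, Real.exp (κ * a i (α • x + β • y) - (α * p + β * q)) ≤ 1 := by
    calc ∑ i ∈ t, Real.exp (κ * a i (α • x + β • y) - (α * p + β * q))
        ≤ ∑ i ∈ t, (α * Real.exp (κ * a i x - p) + β * Real.exp (κ * a i y - q)) := by
          refine Finset.sum_le_sum fun i _ => ?_
          have e1 := (ha i).2 (mem_univ x) (mem_univ y) hα hβ hαβ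
          have e2 := convexOn_exp.2 (mem_univ (κ * a i x - p)) (mem_univ (κ * a i y - q))
            hα hβ hαβ
          simp only [smul_eq_mul] at e1 e2
          refine (Real.exp_le_exp.mpr ?_).trans e2
          nlinarith [mul_le_mul_of_nonneg_left e1 hκ.le]
      _ = 1 := by
          rw [Finset.sum_add_distrib, ← Finset.mul_sum, ← Finset.mul_sum, hp, hq, hnorm, hnorm]
          linarith
  have h2 : ∑ i ∈ t, Real.exp (κ * a i (α • x + β • y)) ≤ Real.exp (α * p + β * q) := by
    simp only [Real.exp_sub] at h1
    rwa [← Finset.sum_div, div_le_one (Real.exp_pos _)] at h1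
  have h3 := Real.log_le_log (sum_exp_pos ht _) h2
  rw [Real.log_exp] at h3
  simp only [softMax, smul_eq_mul, ← hp, ← hq]
  calc _ ≤ κ⁻¹ * (α * p + β * q) := mul_le_mul_of_nonneg_left h3 (by positivity)
    _ = _ := by ring

end SoftMax

namespace LabelledPolytope

variable {m : ℕ} (P : LabelledPolytope m)

theorem convexOn_ext_of_convexOn {F : E m → ℝ} (hF : ConvexOn ℝ P.Δ F) {f : C(P.Δ, ℝ)}
    (hf : ∀ x : P.Δ, f x = F x) : f ∈ P.convexFun :=
  hF.congr fun x hx => by rw [P.ext_apply f hx, hf]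

/-- The restrictions of the smooth convex functions on `ℝ^m` are dense in `𝓒(Δ)`. A convex function
is nearly attained at each point by an affine minorant; finitely many of these suffice by
compactness, and their smooth maximum is the approximation. -/
theorem exists_contDiff_convex_near {f : C(P.Δ, ℝ)} (hf : f ∈ P.convexFun) {r : ℝ} (hr : 0 < r) :
    ∃ F : E m → ℝ, ContDiff ℝ ∞ F ∧ ConvexOn ℝ univ F ∧ ∃ g : C(P.Δ, ℝ),
      (∀ x : P.Δ, g x = F x) ∧ ‖g - f‖ < r := by
  have haff : ∀ x : P.Δ, ∃ (l : E m →L[ℝ] ℝ) (c : ℝ), (∀ y : P.Δ, l y + c ≤ f y) ∧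
      l x + c = f x - r / 4 := by
    intro x
    have hlt : f x - r / 4 < P.ext f x := by
      rw [P.ext_apply f x.2]
      linarith
    obtain ⟨l, c, h1, h2⟩ := ConvexOn.exists_affine_le_of_lt (𝕜 := ℝ) x.2 hlt P.isClosed_Δ
      (P.continuousOn_ext f).lowerSemicontinuousOn hf
    refine ⟨l, c, fun y => ?_, h2⟩
    have h3 := h1 y
    simp only [Pi.add_apply, domRestrict_apply, Function.comp_apply, Function.const_apply] at h3
    rw [P.ext_apply f y.2] at h3
    exact h3
  choose l c hle heq using haff
  let U : P.Δ → Set P.Δ := fun x => {y | f y - r / 2 < l x y + c x}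
  have hU : ∀ x, U x ∈ nhds x := fun x => by
    refine (isOpen_lt (by fun_prop) (by fun_prop)).mem_nhds ?_
    change f x - r / 2 < l x x + c x
    rw [heq]
    linarith
  obtain ⟨t, ht⟩ := CompactSpace.elim_nhds_subcover U hU
  have hcov : ∀ y : P.Δ, ∃ x ∈ t, f y - r / 2 < l x y + c x := fun y => by
    have : y ∈ ⋃ x ∈ t, U x := by rw [ht]; trivial
    simpa [U] using this
  obtain ⟨x₀, hx₀⟩ := P.interior_nonempty
  have htne : t.Nonempty := by
    obtain ⟨x, hx, -⟩ := hcov ⟨x₀, interior_subset hx₀⟩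
    exact ⟨x, hx⟩
  have hlog : 0 ≤ Real.log t.card := Real.log_natCast_nonneg _
  -- large enough for the smooth maximum to exceed the maximum by at most `r / 4`
  let κ : ℝ := 4 * (Real.log t.card + 1) / r
  have hκ : 0 < κ := by positivity
  have hκ' : κ⁻¹ * Real.log t.card ≤ r / 4 := by
    simp only [κ, inv_div, div_mul_eq_mul_div]
    rw [div_le_iff₀ (by positivity)]
    nlinarith
  let a : P.Δ → E m → ℝ := fun x y => l x y + c x
  have hac : ∀ x, ContDiff ℝ ∞ (a x) := fun x => (l x).contDiff.add contDiff_const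
  have hav : ∀ x, ConvexOn ℝ univ (a x) := fun x =>
    ((l x).toLinearMap.convexOn convex_univ).add_const _
  have hF := contDiff_softMax (κ := κ) htne hac
  refine ⟨softMax t κ a, hF, convexOn_softMax hκ htne hav,
    ⟨fun x => softMax t κ a x, hF.continuous.comp continuous_subtype_val⟩, fun x => rfl, ?_⟩
  rw [ContinuousMap.norm_lt_iff _ hr]
  intro y
  rw [ContinuousMap.sub_apply, ContinuousMap.coe_mk, Real.norm_eq_abs, abs_lt]
  constructor
  · obtain ⟨x, hx, hxy⟩ := hcov y
    have h1 : a x y ≤ softMax t κ a y := le_softMax hκ hx _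
    have h2 : f y - r / 2 < a x y := hxy
    linarith
  · have h1 : softMax t κ a y ≤ f y + κ⁻¹ * Real.log t.card :=
      softMax_le hκ htne fun x _ => hle x y
    linarith

/-! ### Rays of symplectic potentials -/

/-- The canonical potential as a continuous function on `Δ`. -/
def canonicalFun : C(P.Δ, ℝ) :=
  ⟨fun x => P.canonical x, P.continuous_canonical.comp continuous_subtype_val⟩

theorem ext_eqOn_interior {f : C(P.Δ, ℝ)} {F : E m → ℝ} (hf : ∀ x : P.Δ, f x = F x) :
    EqOn (P.ext f) F (interior P.Δ) := fun x hx => by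
  rw [P.ext_apply f (interior_subset hx), hf]

theorem mem_convexSmooth_of_eq {f : C(P.Δ, ℝ)} {F : E m → ℝ} (hf : ∀ x : P.Δ, f x = F x)
    (hF : ConvexOn ℝ P.Δ F) (hs : ContDiffOn ℝ ∞ F (interior P.Δ)) : f ∈ P.convexSmooth :=
  ⟨P.convexOn_ext_of_convexOn hF hf, hs.congr fun _ hx => P.ext_eqOn_interior hf hx⟩

theorem hess_congr_of_eqOn {U : Set (E m)} (hU : IsOpen U) {f g : E m → ℝ} (h : EqOn f g U)
    {x : E m} (hx : x ∈ U) : hess f x = hess g x := by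
  have h1 : f =ᶠ[nhds x] g := Filter.eventuallyEq_of_mem (hU.mem_nhds hx) h
  ext i j
  simp only [hess, Matrix.of_apply, h1.fderiv.fderiv_eq]

theorem hess_add_smul {U : Set (E m)} (hU : IsOpen U) {f g : E m → ℝ} (hf : ContDiffOn ℝ ∞ f U)
    (hg : ContDiffOn ℝ ∞ g U) (k : ℝ) {x : E m} (hx : x ∈ U) :
    hess (fun y => f y + k * g y) x = hess f x + k • hess g x := by
  have hd : ∀ {φ : E m → ℝ}, ContDiffOn ℝ ∞ φ U → ∀ y ∈ U, DifferentiableAt ℝ φ y :=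
    fun hφ y hy => (hφ.differentiableOn (by simp)).differentiableAt (hU.mem_nhds hy)
  have hd2 : ∀ {φ : E m → ℝ}, ContDiffOn ℝ ∞ φ U → ∀ y ∈ U, DifferentiableAt ℝ (fderiv ℝ φ) y :=
    fun {φ} hφ y hy => by
      have h0 : ContDiffOn ℝ ∞ (fderiv ℝ φ) U := hφ.fderiv_of_isOpen hU (by simp)
      exact (h0.differentiableOn (by simp)).differentiableAt (hU.mem_nhds hy)
  have h1 : fderiv ℝ (fun y => f y + k * g y) =ᶠ[nhds x]
      fun y => fderiv ℝ f y + k • fderiv ℝ g y := by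
    filter_upwards [hU.mem_nhds hx] with y hy
    rw [fderiv_fun_add (hd hf y hy) ((hd hg y hy).const_mul k), fderiv_const_mul (hd hg y hy)]
  have h2 : fderiv ℝ (fun y => fderiv ℝ f y + k • fderiv ℝ g y) x =
      fderiv ℝ (fderiv ℝ f) x + k • fderiv ℝ (fderiv ℝ g) x := by
    have h3 : HasFDerivAt (fun y => k • fderiv ℝ g y) (k • fderiv ℝ (fderiv ℝ g) x) x :=
      (hd2 hg x hx).hasFDerivAt.fun_const_smul k
    exact ((hd2 hf x hx).hasFDerivAt.fun_add h3).fderiv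
  ext i j
  simp only [hess, Matrix.of_apply, h1.fderiv_eq, h2, Matrix.add_apply, Matrix.smul_apply]
  rfl

variable {F : E m → ℝ} {f : C(P.Δ, ℝ)}

theorem hess_canonicalFun_add_smul (hF : ContDiff ℝ ∞ F) (hf : ∀ x : P.Δ, f x = F x) (k : ℝ)
    {x : E m} (hx : x ∈ interior P.Δ) :
    hess (P.ext (P.canonicalFun + k • f)) x = hess P.canonical x + k • hess F x := by
  rw [← hess_add_smul isOpen_interior P.contDiffOn_canonical hF.contDiffOn k hx]
  refine hess_congr_of_eqOn isOpen_interior (P.ext_eqOn_interior fun y => ?_) hx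
  simp [canonicalFun, hf]

/-- The ray from the canonical potential in the direction of a smooth convex function consists of
symplectic potentials. -/
theorem canonicalFun_add_smul_mem (hF : ContDiff ℝ ∞ F) (hc : ConvexOn ℝ univ F)
    (hf : ∀ x : P.Δ, f x = F x) {k : ℝ} (hk : 0 < k) :
    P.canonicalFun + k • f ∈ P.symplecticPotentials := by
  have hH := fun {x : E m} (hx : x ∈ interior P.Δ) => P.hess_canonicalFun_add_smul hF hf k hx
  have hpsd : ∀ x, (k • hess F x).PosSemidef := fun x => (posSemidef_hess hF hc x).smul hk.le
  refine ⟨?_, fun x hx => ?_, ⟨fun x => k • hess F x, fun i j => ?_, fun x hx => ?_⟩, ?_⟩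
  · refine P.mem_convexSmooth_of_eq (F := fun x => P.canonical x + k * F x) (fun x => ?_)
      (P.convexOn_canonical.add ((hc.subset (subset_univ _) P.convex_Δ).smul hk.le))
      (P.contDiffOn_canonical.add (contDiff_const.mul hF).contDiffOn)
    simp [canonicalFun, hf]
  · rw [hH hx]
    exact (P.posDef_hess_canonical hx).add_posSemidef (hpsd x)
  · exact (contDiff_hess_apply hF i j).const_smul k
  · simp only [hH hx, add_sub_cancel_left]
  · obtain ⟨W, hW, hW'⟩ := P.exists_contDiff_eq_inverseBlock
    refine ⟨fun x => 1 + W x * ((2 * k) • hess F x), ⟨fun i j => ?_, fun x hx => ?_⟩,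
      fun x hx => ?_⟩
    · simp only [Matrix.add_apply, Matrix.mul_apply, Matrix.smul_apply]
      exact contDiff_const.add (ContDiff.sum fun l _ =>
        (hW i l).mul ((contDiff_hess_apply hF l j).const_smul (2 * k)))
    · have hu : IsUnit (hess P.canonical x).det :=
        isUnit_iff_ne_zero.mpr (P.posDef_hess_canonical hx).det_pos.ne'
      simp only [hH hx, Matrix.mul_add, Matrix.nonsing_inv_mul _ hu]
      simp only [P.inv_hess_canonical hx, hW' x (interior_subset hx), smul_mul_smul_comm,
        Matrix.mul_smul]
    · simp only [hW' x hx]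
      exact isUnit_det_one_add_mul (P.inverseBlock_nonneg hx)
        ((posSemidef_hess hF hc x).smul (by positivity))

/-- Along such a ray the entropy term has a favourable sign, as `log det` is increasing. -/
theorem kEnergy_canonicalFun_add_smul_le (hF : ContDiff ℝ ∞ F) (hc : ConvexOn ℝ univ F)
    (hf : ∀ x : P.Δ, f x = F x) {k : ℝ} (hk : 0 < k) :
    P.kEnergy (P.canonicalFun + k • f) ≤ P.futaki P.canonicalFun + k * P.futaki f := by
  rw [kEnergy, P.futaki_add, P.futaki_smul]
  refine sub_le_self _ (setIntegral_nonneg isOpen_interior.measurableSet fun x hx => ?_)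
  rw [P.hess_canonicalFun_add_smul hF hf k hx, sub_nonneg]
  exact Real.log_le_log (P.posDef_hess_canonical hx).det_pos
    (det_le_det_add (P.posDef_hess_canonical hx) ((posSemidef_hess hF hc x).smul hk.le))

theorem IsAffine.add_smul {g₁ g₂ : C(P.Δ, ℝ)} (h₁ : P.IsAffine g₁) (h₂ : P.IsAffine g₂) (k : ℝ) :
    P.IsAffine (g₁ + k • g₂) := by
  obtain ⟨a, ha⟩ := h₁
  obtain ⟨b, hb⟩ := h₂
  exact ⟨a + k • b, fun x => by simp [ha, hb]⟩

variable {P} in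
theorem IsNormalization.add_smul {S : Set C(P.Δ, ℝ)} (hS : P.IsSlice S) {f g h₁ h₂ : C(P.Δ, ℝ)}
    (h₁f : P.IsNormalization S f h₁) (h₂g : P.IsNormalization S g h₂) {k : ℝ} (hk : 0 < k) :
    P.IsNormalization S (f + k • g) (h₁ + k • h₂) := by
  refine ⟨?_, ?_⟩
  · simpa using hS.combination h₁ h₁f.1 h₂ h₂g.1 1 k one_pos hk
  · have := IsAffine.add_smul P h₁f.2 h₂g.2 k
    rwa [show f - h₁ + k • (g - h₂) = f + k • g - (h₁ + k • h₂) by module] at this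

theorem le_of_forall_pos_mul_le {a b : ℝ} (h : ∀ k : ℝ, 0 < k → k * a ≤ b) : a ≤ 0 := by
  by_contra! ha
  have h1 := h ((|b| + 1) / a) (by positivity)
  rw [div_mul_cancel₀ _ ha.ne'] at h1
  linarith [le_abs_self b]

/-- Coercivity of the relative K-energy bounds the invariant from below on smooth convex functions:
compare the growth of both sides along the ray. -/
theorem mul_seminorm_le_futaki_of_contDiff {S : Set C(P.Δ, ℝ)} (hS : P.IsSlice S)
    (p : Seminorm ℝ C(P.Δ, ℝ)) {δ Cδ : ℝ} (hδ : 0 ≤ δ)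
    (hE : ∀ u ∈ P.symplecticPotentials, ∀ πu, P.IsNormalization S u πu →
      δ * p πu + Cδ ≤ P.kEnergy u)
    (hF : ContDiff ℝ ∞ F) (hc : ConvexOn ℝ univ F) (hf : ∀ x : P.Δ, f x = F x)
    {h : C(P.Δ, ℝ)} (hh : P.IsNormalization S f h) : δ * p h ≤ P.futaki f := by
  have hcan : P.canonicalFun ∈ P.convexFun :=
    P.convexOn_ext_of_convexOn P.convexOn_canonical fun x => rfl
  obtain ⟨h₀, hh₀⟩ := hS.exists_normalization _ hcan
  have key : ∀ k : ℝ, 0 < k → k * (δ * p h - P.futaki f) ≤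
      P.futaki P.canonicalFun - Cδ + δ * p h₀ := by
    intro k hk
    have h1 := hE _ (P.canonicalFun_add_smul_mem hF hc hf hk) _ (hh₀.add_smul hS hh hk)
    have h2 := P.kEnergy_canonicalFun_add_smul_le hF hc hf hk
    have h3 : k * p h ≤ p (h₀ + k • h) + p h₀ := by
      have h4 : p (k • h) = k * p h := by rw [map_smul_eq_mul, Real.norm_of_nonneg hk.le]
      have h5 := map_sub_le_add p (h₀ + k • h) h₀
      rwa [add_sub_cancel_left, h4] at h5
    nlinarith [mul_le_mul_of_nonneg_left h3 hδ]
  linarith [le_of_forall_pos_mul_le key]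

theorem futaki_bound_of_kEnergy_bound {S : Set C(P.Δ, ℝ)} (hS : P.IsSlice S) (hS' : P.IsStable S)
    (p : Seminorm ℝ C(P.Δ, ℝ)) (hp : P.IsTamed S p) {lam : ℝ} (hlam : 0 < lam)
    (hE : ∀ δ : ℝ, 0 ≤ δ → δ < lam → ∃ Cδ : ℝ, ∀ u ∈ P.symplecticPotentials,
      ∀ πu, P.IsNormalization S u πu → δ * p πu + Cδ ≤ P.kEnergy u) :
    ∀ f ∈ P.convexFun, ∀ πf, P.IsNormalization S f πf → lam * p πf ≤ P.futaki f := by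
  have hsmooth : ∀ (F : E m → ℝ) (f h : C(P.Δ, ℝ)), ContDiff ℝ ∞ F → ConvexOn ℝ univ F →
      (∀ x : P.Δ, f x = F x) → P.IsNormalization S f h → lam * p h ≤ P.futaki h := by
    intro F f h hF hc hf hh
    rw [← P.futaki_eq_of_isAffine_sub hh.2]
    have h1 : ∀ δ ∈ Ico 0 lam, δ * p h ≤ P.futaki f := fun δ hδ => by
      obtain ⟨Cδ, hCδ⟩ := hE δ hδ.1 hδ.2
      exact P.mul_seminorm_le_futaki_of_contDiff hS p hδ.1 hCδ hF hc hf hh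
    refine le_of_tendsto (f := fun δ : ℝ => δ * p h) (x := nhdsWithin lam (Iio lam))
      ((continuous_id.mul continuous_const).continuousWithinAt.tendsto) ?_
    filter_upwards [Ico_mem_nhdsLT hlam] with δ hδ using h1 δ hδ
  intro f hf h hh
  rw [P.futaki_eq_of_isAffine_sub hh.2]
  obtain ⟨C, hC0, -, hC⟩ := hp
  obtain ⟨K, hK0, hK⟩ := P.exists_futaki_le_norm
  refine le_of_forall_pos_le_add fun ε hε => ?_
  obtain ⟨f₀, hf₀, r, hr, hnear⟩ := hS' h hh.1 (ε / (K + lam * C)) (by positivity)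
  obtain ⟨F, hF, hc, g, hg, hgf⟩ := P.exists_contDiff_convex_near hf₀ hr
  have hgc : g ∈ P.convexFun :=
    P.convexOn_ext_of_convexOn (hc.subset (subset_univ _) P.convex_Δ) hg
  obtain ⟨h', hh'⟩ := hS.exists_normalization g hgc
  have hclose := hnear g hgc hgf h' hh'
  rw [lt_div_iff₀ (by positivity)] at hclose
  have h1 := hsmooth F g h' hF hc hg hh'
  have h2 : P.futaki h' ≤ P.futaki h + K * ‖h' - h‖ := by
    have := P.futaki_add (h' - h) h
    rw [sub_add_cancel] at this
    linarith [hK (h' - h)]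
  have h3 : p h ≤ p h' + C * ‖h' - h‖ := by
    have h4 := map_sub_le_add p h' (h' - h)
    rw [sub_sub_cancel] at h4
    linarith [hC (h' - h)]
  nlinarith [mul_le_mul_of_nonneg_left h3 hlam.le]

/-! ### Integral bounds over the polytope -/

/-- A convex function is bounded below by a multiple of its `L^1` norm: integrate
`h(y) ≥ 2 h((y + z) / 2) - h(z)` over `z ∈ Δ`. -/
theorem exists_neg_mul_integral_abs_le : ∃ C : ℝ, 0 ≤ C ∧ ∀ h ∈ P.convexFun, ∀ y ∈ P.Δ,
    -(C * ∫ x in P.Δ, |P.ext h x|) ≤ P.ext h y := by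
  have hvol := P.volume_real_Δ_pos
  refine ⟨(2 * 2 ^ m + 1) / volume.real P.Δ, by positivity, fun h hh y hy => ?_⟩
  set I := ∫ x in P.Δ, |P.ext h x| with hI
  have hsupp : Function.support (fun x => |P.ext h x|) ⊆ P.Δ := fun x hx => by
    by_contra hxΔ
    exact hx (by simp [P.ext_apply_of_notMem h hxΔ])
  have hint : Integrable fun x => |P.ext h x| :=
    (integrableOn_iff_integrable_of_support_subset hsupp).mp (P.integrableOn_ext h).abs
  have hIall : ∫ x, |P.ext h x| = I := by
    rw [hI, setIntegral_eq_integral_of_forall_compl_eq_zero]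
    intro x hx
    rw [P.ext_apply_of_notMem h hx, abs_zero]
  have hmid : ∫ z, |P.ext h ((2 : ℝ)⁻¹ • (y + z))| = 2 ^ m * I := by
    rw [integral_add_left_eq_self (fun z => |P.ext h ((2 : ℝ)⁻¹ • z)|) y,
      Measure.integral_comp_smul volume (fun x => |P.ext h x|) (2 : ℝ)⁻¹, hIall,
      finrank_euclideanSpace_fin, inv_pow, inv_inv, smul_eq_mul, abs_of_nonneg (by positivity)]
  have hmid_int : Integrable fun z => |P.ext h ((2 : ℝ)⁻¹ • (y + z))| :=
    (hint.comp_smul (by norm_num : (2 : ℝ)⁻¹ ≠ 0)).comp_add_left y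
  have hpt : ∀ z ∈ P.Δ, -(2 * |P.ext h ((2 : ℝ)⁻¹ • (y + z))| + |P.ext h z|) ≤ P.ext h y := by
    intro z hz
    have h1 := hh.2 hy hz (by norm_num : (0 : ℝ) ≤ 2⁻¹) (by norm_num : (0 : ℝ) ≤ 2⁻¹)
      (by norm_num)
    rw [← smul_add] at h1
    simp only [smul_eq_mul] at h1
    have h2 := neg_abs_le (P.ext h ((2 : ℝ)⁻¹ • (y + z)))
    have h3 := le_abs_self (P.ext h z)
    linarith
  have h1 : ∫ z in P.Δ, -(2 * |P.ext h ((2 : ℝ)⁻¹ • (y + z))| + |P.ext h z|) ≤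
      ∫ _z in P.Δ, P.ext h y := by
    refine setIntegral_mono_on ?_ ?_ P.measurableSet_Δ hpt
    · exact ((hmid_int.const_mul 2).add hint).neg.integrableOn
    · exact integrableOn_const P.volume_Δ_lt_top.ne
  rw [integral_neg, integral_add (hmid_int.const_mul 2).integrableOn hint.integrableOn,
    integral_const_mul, setIntegral_const, smul_eq_mul, ← hI] at h1
  have h2 : ∫ z in P.Δ, |P.ext h ((2 : ℝ)⁻¹ • (y + z))| ≤ 2 ^ m * I := by
    rw [← hmid]
    exact setIntegral_le_integral hmid_int (.of_forall fun _ => abs_nonneg _)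
  rw [div_mul_eq_mul_div, neg_le, ← sub_nonneg, ← mul_nonneg_iff_of_pos_left hvol, mul_sub,
    mul_div_cancel₀ _ hvol.ne']
  linarith

/-- The part of `Δ` where a label is small is a thin collar: it misses the homothetic copy of `Δ`
with ratio `1 - ε` about an interior point. -/
theorem volume_L_lt_le {x₀ : E m} (hx₀ : x₀ ∈ P.Δ) (j : Fin P.d) {ε : ℝ} (hε : 0 < ε) :
    volume {x | x ∈ P.Δ ∧ P.L j x < P.L j x₀ * ε} ≤ ENNReal.ofReal ((m + 1) * ε) * volume P.Δ := by
  rcases le_or_gt 1 ε with h1 | h1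
  · calc volume {x | x ∈ P.Δ ∧ P.L j x < P.L j x₀ * ε} ≤ 1 * volume P.Δ := by
          rw [one_mul]
          exact measure_mono fun x hx => hx.1
      _ ≤ _ := by
          gcongr
          rw [ENNReal.one_le_ofReal]
          have : (0 : ℝ) ≤ m := m.cast_nonneg
          nlinarith
  set A := AffineMap.homothety x₀ (1 - ε) '' P.Δ with hA
  have hpt : ∀ y, AffineMap.homothety x₀ (1 - ε) y = ε • x₀ + (1 - ε) • y := fun y => by
    simp only [AffineMap.homothety_apply, vsub_eq_sub, vadd_eq_add]
    module
  have hAsub : A ⊆ P.Δ := by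
    rintro _ ⟨y, hy, rfl⟩
    rw [hpt]
    exact P.convex_Δ hx₀ hy hε.le (by linarith) (by ring)
  have hAm : NullMeasurableSet A volume :=
    (P.isCompact.image (AffineMap.homothety_continuous x₀ (1 - ε))).measurableSet.nullMeasurableSet
  have hsub : {x | x ∈ P.Δ ∧ P.L j x < P.L j x₀ * ε} ⊆ P.Δ \ A := by
    rintro x ⟨hx, hlt⟩
    refine ⟨hx, ?_⟩
    rintro ⟨y, hy, rfl⟩
    rw [hpt, P.L_combo j (by ring)] at hlt
    have := mul_nonneg (by linarith : 0 ≤ 1 - ε) (P.mem_Δ.mp hy j)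
    linarith
  have hvolA : volume A = ENNReal.ofReal ((1 - ε) ^ m) * volume P.Δ := by
    rw [hA, Measure.addHaar_image_homothety, finrank_euclideanSpace_fin, abs_of_nonneg]
    exact pow_nonneg (by linarith) _
  refine (measure_mono hsub).trans ?_
  rw [measure_sdiff hAsub hAm (ne_top_of_le_ne_top P.volume_Δ_lt_top.ne (measure_mono hAsub)),
    tsub_le_iff_right, hvolA, ← add_mul, ← ENNReal.ofReal_add (by positivity)
      (pow_nonneg (by linarith) _)]
  refine le_mul_of_one_le_left (zero_le) ?_
  rw [ENNReal.one_le_ofReal]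
  have hb := one_add_mul_le_pow (a := -ε) (by linarith) m
  rw [← sub_eq_add_neg] at hb
  linarith

/-- By the layer cake formula: `log M - log L_j` exceeds `t` only on a collar of volume
`O(exp (-t))`. -/
theorem integrableOn_log_L (j : Fin P.d) :
    IntegrableOn (fun x => Real.log (P.L j x)) (interior P.Δ) := by
  obtain ⟨M, hM1, hM, -⟩ := P.exists_bound
  have hM0 : 0 < M := by linarith
  obtain ⟨x₀, hx₀⟩ := P.interior_nonempty
  set c := P.L j x₀ with hc
  have hc0 : 0 < c := P.mem_interior_iff.mp hx₀ j
  let f : E m → ℝ := fun x => Real.log M - Real.log (P.L j x)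
  have hfm : Measurable f :=
    measurable_const.sub (Real.measurable_log.comp (P.continuous_L j).measurable)
  have hae : ∀ᵐ x ∂volume.restrict (interior P.Δ), x ∈ interior P.Δ :=
    ae_restrict_mem isOpen_interior.measurableSet
  have hf0 : 0 ≤ᵐ[volume.restrict (interior P.Δ)] f := hae.mono fun x hx =>
    sub_nonneg.mpr (Real.log_le_log (P.mem_interior_iff.mp hx j) (hM j x (interior_subset hx)))
  have hlevel : ∀ t, volume.restrict (interior P.Δ) {x | t < f x} ≤
      ENNReal.ofReal ((m + 1) * (M / c) * Real.exp (-t)) * volume P.Δ := by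
    intro t
    have h1 := P.volume_L_lt_le (interior_subset hx₀) j
      (ε := M / c * Real.exp (-t)) (by positivity)
    rw [← mul_assoc (m + 1 : ℝ)] at h1
    refine le_trans ?_ h1
    rw [Measure.restrict_apply (show MeasurableSet {x | t < f x} from hfm measurableSet_Ioi)]
    refine measure_mono fun x hx => ⟨interior_subset hx.2, ?_⟩
    have hLx := P.mem_interior_iff.mp hx.2 j
    have h2 : t < Real.log M - Real.log (P.L j x) := hx.1
    have h3 : Real.log (P.L j x) < Real.log (M * Real.exp (-t)) := by
      rw [Real.log_mul hM0.ne' (Real.exp_pos _).ne', Real.log_exp]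
      linarith
    have h4 := (Real.log_lt_log_iff hLx (by positivity)).mp h3
    refine h4.trans_eq ?_
    rw [← hc]
    field_simp
  have hfin : ∫⁻ x in interior P.Δ, ENNReal.ofReal (f x) < ⊤ := by
    rw [lintegral_eq_lintegral_meas_lt _ hf0 hfm.aemeasurable]
    refine (lintegral_mono hlevel).trans_lt ?_
    rw [lintegral_mul_const' _ _ P.volume_Δ_lt_top.ne]
    refine ENNReal.mul_lt_top ?_ P.volume_Δ_lt_top
    exact ((integrableOn_exp_neg_Ioi 0).const_mul _).lintegral_lt_top
  have hfi : IntegrableOn f (interior P.Δ) := by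
    refine ⟨hfm.aestronglyMeasurable, ?_⟩
    rwa [hasFiniteIntegral_iff_ofReal hf0]
  have hconst : IntegrableOn (fun _ : E m => Real.log M) (interior P.Δ) :=
    integrableOn_const (ne_top_of_le_ne_top P.volume_Δ_lt_top.ne (measure_mono interior_subset))
  refine (hconst.sub hfi).congr (.of_forall fun x => ?_)
  simp [f]

theorem integrableOn_log_prod_L :
    IntegrableOn (fun x => Real.log (∏ j, P.L j x)) (interior P.Δ) := by
  have h : IntegrableOn (fun x => ∑ j, Real.log (P.L j x)) (interior P.Δ) :=
    integrable_finsetSum _ fun j _ => P.integrableOn_log_L j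
  refine h.congr_fun (fun x hx => ?_) isOpen_interior.measurableSet
  exact (Real.log_prod fun j _ => (P.mem_interior_iff.mp hx j).ne').symm

/-! ### The entropy of a symplectic potential -/

/-- The integrand is `log det (G₀⁻¹ G)`, which is continuous up to the boundary; so the entropy is a
genuine integral. -/
theorem integrableOn_log_det_sub {u : C(P.Δ, ℝ)} (hu : u ∈ P.symplecticPotentials) :
    IntegrableOn (fun x => Real.log (hess (P.ext u) x).det - Real.log (hess P.canonical x).det)
      (interior P.Δ) := by
  obtain ⟨-, hpd, -, N, ⟨hN, hNeq⟩, hNu⟩ := hu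
  have hcont : ContinuousOn (fun x => Real.log (N x).det) P.Δ :=
    (contDiff_det hN).continuous.continuousOn.log fun x hx => (hNu x hx).ne_zero
  refine ((hcont.integrableOn_compact P.isCompact).mono_set interior_subset).congr_fun
    (fun x hx => ?_) isOpen_interior.measurableSet
  have h0 := (P.posDef_hess_canonical hx).det_pos
  simp only [hNeq x hx]
  rw [Matrix.det_mul, Matrix.det_nonsing_inv, Ring.inverse_eq_inv',
    Real.log_mul (inv_ne_zero h0.ne') (hpd x hx).det_pos.ne', Real.log_inv]
  ring

/-- The entropy is bounded by an arbitrarily small multiple of the weighted trace. -/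
theorem exists_integral_log_det_le {θ : ℝ} (hθ : 0 < θ) : ∃ C : ℝ, ∀ u ∈ P.symplecticPotentials,
    IntegrableOn (fun x => (∏ j, P.L j x) * (hess (P.ext u) x).trace) (interior P.Δ) →
    ∫ x in interior P.Δ, (Real.log (hess (P.ext u) x).det - Real.log (hess P.canonical x).det) ≤
      θ * (∫ x in interior P.Δ, (∏ j, P.L j x) * (hess (P.ext u) x).trace) + C := by
  obtain ⟨c, hc⟩ := P.exists_le_log_det_hess_canonical
  let b : E m → ℝ := fun x => -(m * Real.log θ) - c - m * Real.log (∏ j, P.L j x)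
  have hb : IntegrableOn b (interior P.Δ) := by
    have hconst : IntegrableOn (fun _ : E m => -(m * Real.log θ) - c) (interior P.Δ) :=
      integrableOn_const (ne_top_of_le_ne_top P.volume_Δ_lt_top.ne (measure_mono interior_subset))
    exact hconst.sub (P.integrableOn_log_prod_L.const_mul _)
  refine ⟨∫ x in interior P.Δ, b x, fun u hu hint => ?_⟩
  rw [← integral_const_mul, ← integral_add (hint.const_mul θ) hb]
  refine setIntegral_mono_on (P.integrableOn_log_det_sub hu) ((hint.const_mul θ).add hb)
    isOpen_interior.measurableSet fun x hx => ?_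
  have hφ : 0 < ∏ j, P.L j x := Finset.prod_pos fun j _ => P.mem_interior_iff.mp hx j
  have h1 := log_det_le_smul_trace (hu.2.1 x hx) (mul_pos hθ hφ)
  rw [Real.log_mul hθ.ne' hφ.ne', Fintype.card_fin] at h1
  have h2 := hc x hx
  have h3 : (0 : ℝ) ≤ m := m.cast_nonneg
  simp only [b]
  linarith

theorem hess_eq_of_isAffine_sub {u v : C(P.Δ, ℝ)} (h : P.IsAffine (v - u))
    (hu : ContDiffOn ℝ ∞ (P.ext u) (interior P.Δ)) :
    ContDiffOn ℝ ∞ (P.ext v) (interior P.Δ) ∧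
    ∀ x ∈ interior P.Δ, hess (P.ext v) x = hess (P.ext u) x := by
  obtain ⟨a, ha⟩ := h
  let l : E m →L[ℝ] ℝ := LinearMap.toContinuousLinearMap a.linear
  have hal : ⇑a = fun x => l x + a 0 := a.decomp
  have hac : ContDiff ℝ ∞ a := by
    rw [hal]
    exact l.contDiff.add contDiff_const
  have heq : EqOn (P.ext v) (fun x => P.ext u x + 1 * a x) (interior P.Δ) := fun x hx => by
    have := ha ⟨x, interior_subset hx⟩
    rw [ContinuousMap.sub_apply] at this
    simp only [P.ext_apply _ (interior_subset hx), one_mul, ← this]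
    ring
  have ha0 : ∀ x, hess a x = 0 := by
    intro x
    have h1 : fderiv ℝ a = fun _ => l := by
      rw [hal]
      exact funext fun y => (l.hasFDerivAt.add_const (a 0)).fderiv
    ext i j
    simp [hess, h1]
  refine ⟨(hu.add (contDiff_const.mul hac).contDiffOn).congr heq, fun x hx => ?_⟩
  rw [hess_congr_of_eqOn isOpen_interior heq hx,
    hess_add_smul isOpen_interior hu hac.contDiffOn 1 hx, ha0, smul_zero, add_zero]

/-- The weighted trace of the Hessian of a symplectic potential is bounded by the invariant and the
norm of its normalization. -/
theorem exists_integral_trace_le {S : Set C(P.Δ, ℝ)} (hS : P.IsSlice S)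
    {p : Seminorm ℝ C(P.Δ, ℝ)} (hp : P.IsTamed S p) : ∃ K A : ℝ, 0 ≤ K ∧ 0 ≤ A ∧
    ∀ u ∈ P.symplecticPotentials, ∀ h, P.IsNormalization S u h →
      IntegrableOn (fun x => (∏ j, P.L j x) * (hess (P.ext u) x).trace) (interior P.Δ) ∧
      ∫ x in interior P.Δ, (∏ j, P.L j x) * (hess (P.ext u) x).trace ≤
        K * (P.futaki u + A * p h) := by
  obtain ⟨K, hK0, hK⟩ := P.exists_lintegral_trace_hess_le
  obtain ⟨B, hB0, hB⟩ := P.exists_extremal_bound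
  obtain ⟨C₁, hC₁0, hC₁⟩ := P.exists_neg_mul_integral_abs_le
  obtain ⟨C, hC0, hC, -⟩ := hp
  refine ⟨K / 2, B * (1 + C₁ * volume.real P.Δ) * C, by positivity, by positivity,
    fun u hu h hh => ?_⟩
  set I := ∫ x in P.Δ, |P.ext h x| with hI
  have hI0 : 0 ≤ I := integral_nonneg fun _ => abs_nonneg _
  have hIp : I ≤ C * p h := by
    have := hC h hh.1
    rwa [inv_mul_le_iff₀ hC0] at this
  -- raise the normalized potential by a constant to make it nonnegative
  let v : C(P.Δ, ℝ) := h + ContinuousMap.const _ (C₁ * I)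
  have hvx : ∀ x ∈ P.Δ, P.ext v x = P.ext h x + C₁ * I := fun x hx => by
    simp [v, P.ext_apply _ hx]
  have hv0 : ∀ x, 0 ≤ P.ext v x := fun x => by
    by_cases hx : x ∈ P.Δ
    · rw [hvx x hx]
      linarith [hC₁ h (hS.subset hh.1) x hx]
    · rw [P.ext_apply_of_notMem v hx]
  have hvu : P.IsAffine (v - u) := by
    obtain ⟨a, ha⟩ := hh.2
    refine ⟨AffineMap.const ℝ (E m) (C₁ * I) - a, fun x => ?_⟩
    have := ha x
    simp only [ContinuousMap.sub_apply] at this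
    simp only [v, ContinuousMap.sub_apply, ContinuousMap.add_apply, ContinuousMap.const_apply,
      AffineMap.coe_sub, Pi.sub_apply, AffineMap.const_apply, ← this]
    ring
  obtain ⟨hvs, hvh⟩ := P.hess_eq_of_isAffine_sub hvu hu.1.2
  have hmain := hK v hvs hv0 fun x hx => by
    rw [hvh x hx]
    exact (hu.2.1 x hx).posSemidef
  rw [← ofReal_integral_eq_lintegral_ofReal (P.integrable_ext_σ v) (.of_forall hv0),
    ← ENNReal.ofReal_mul hK0] at hmain
  have hae : ∀ᵐ x ∂volume.restrict (interior P.Δ), x ∈ interior P.Δ :=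
    ae_restrict_mem isOpen_interior.measurableSet
  have hnn : 0 ≤ᵐ[volume.restrict (interior P.Δ)]
      fun x => (∏ j, P.L j x) * (hess (P.ext v) x).trace := hae.mono fun x hx => by
    refine mul_nonneg (Finset.prod_nonneg fun j _ => (P.mem_interior_iff.mp hx j).le) ?_
    rw [hvh x hx]
    exact (hu.2.1 x hx).posSemidef.trace_nonneg
  have hmeas : AEStronglyMeasurable (fun x => (∏ j, P.L j x) * (hess (P.ext v) x).trace)
      (volume.restrict (interior P.Δ)) := by
    refine ContinuousOn.aestronglyMeasurable (ContinuousOn.mul ?_ ?_)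
      isOpen_interior.measurableSet
    · exact (continuous_finsetProd _ fun j _ => P.continuous_L j).continuousOn
    · have h1 : ContDiffOn ℝ ∞ (fderiv ℝ (P.ext v)) (interior P.Δ) :=
        hvs.fderiv_of_isOpen isOpen_interior (by simp)
      have h2 : ContDiffOn ℝ ∞ (fderiv ℝ (fderiv ℝ (P.ext v))) (interior P.Δ) :=
        h1.fderiv_of_isOpen isOpen_interior (by simp)
      exact continuousOn_finsetSum _ fun i _ =>
        (h2.continuousOn.clm_apply continuousOn_const).clm_apply continuousOn_const
  have hintv : IntegrableOn (fun x => (∏ j, P.L j x) * (hess (P.ext v) x).trace)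
      (interior P.Δ) := by
    refine ⟨hmeas, ?_⟩
    rw [hasFiniteIntegral_iff_ofReal hnn]
    exact hmain.trans_lt ENNReal.ofReal_lt_top
  have hσ0 : 0 ≤ ∫ x, P.ext v x ∂P.σ := integral_nonneg hv0
  rw [← ofReal_integral_eq_lintegral_ofReal hintv hnn,
    ENNReal.ofReal_le_ofReal_iff (by positivity)] at hmain
  have hcongr : EqOn (fun x => (∏ j, P.L j x) * (hess (P.ext v) x).trace)
      (fun x => (∏ j, P.L j x) * (hess (P.ext u) x).trace) (interior P.Δ) := fun x hx => by
    simp only [hvh x hx]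
  refine ⟨hintv.congr_fun hcongr isOpen_interior.measurableSet, ?_⟩
  rw [← setIntegral_congr_fun isOpen_interior.measurableSet hcongr]
  have hvint : ∫ x in P.Δ, |P.ext v x| ≤ (1 + C₁ * volume.real P.Δ) * I := by
    have h1 : ∫ x in P.Δ, |P.ext v x| ≤ ∫ x in P.Δ, (|P.ext h x| + C₁ * I) := by
      refine setIntegral_mono_on (P.integrableOn_ext v).abs
        ((P.integrableOn_ext h).abs.add (integrableOn_const P.volume_Δ_lt_top.ne))
        P.measurableSet_Δ fun x hx => ?_
      rw [abs_of_nonneg (hv0 x), hvx x hx]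
      linarith [le_abs_self (P.ext h x)]
    rw [integral_add (P.integrableOn_ext h).abs (integrableOn_const P.volume_Δ_lt_top.ne),
      setIntegral_const, smul_eq_mul] at h1
    linarith
  have hbd := P.two_mul_integral_σ_le hB v
  rw [P.futaki_eq_of_isAffine_sub hvu] at hbd
  have hfac : 0 ≤ 1 + C₁ * volume.real P.Δ := by positivity
  have h5 : B * ∫ x in P.Δ, |P.ext v x| ≤ B * (1 + C₁ * volume.real P.Δ) * C * p h := by
    calc B * ∫ x in P.Δ, |P.ext v x| ≤ B * ((1 + C₁ * volume.real P.Δ) * (C * p h)) :=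
          mul_le_mul_of_nonneg_left (hvint.trans (mul_le_mul_of_nonneg_left hIp hfac)) hB0
      _ = _ := by ring
  calc _ ≤ K * ∫ x, P.ext v x ∂P.σ := hmain
    _ = K / 2 * (2 * ∫ x, P.ext v x ∂P.σ) := by ring
    _ ≤ _ := mul_le_mul_of_nonneg_left (by linarith) (by positivity)

theorem kEnergy_bound_of_futaki_bound {S : Set C(P.Δ, ℝ)} (hS : P.IsSlice S)
    (p : Seminorm ℝ C(P.Δ, ℝ)) (hp : P.IsTamed S p) {lam : ℝ}
    (hF : ∀ f ∈ P.convexFun, ∀ πf, P.IsNormalization S f πf → lam * p πf ≤ P.futaki f)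
    {δ : ℝ} (hδ0 : 0 ≤ δ) (hδ : δ < lam) : ∃ Cδ : ℝ, ∀ u ∈ P.symplecticPotentials,
      ∀ πu, P.IsNormalization S u πu → δ * p πu + Cδ ≤ P.kEnergy u := by
  obtain ⟨K, A, hK0, hA0, htr⟩ := P.exists_integral_trace_le hS hp
  have hlam : 0 < lam := hδ0.trans_lt hδ
  -- the fraction of the invariant sacrificed to the entropy, `θ K (lam + A) ≤ lam - δ`
  let θ : ℝ := (lam - δ) / ((K + 1) * (lam + A))
  have hθ : 0 < θ := div_pos (by linarith) (by positivity)
  have hθe : θ * ((K + 1) * (lam + A)) = lam - δ := div_mul_cancel₀ _ (by positivity)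
  have hθK : θ * K * (lam + A) ≤ lam - δ := by
    rw [← hθe]
    have : 0 < θ * (lam + A) := by positivity
    linarith
  have hθK1 : θ * K ≤ 1 := by
    by_contra! h
    nlinarith
  obtain ⟨C, hC⟩ := P.exists_integral_log_det_le hθ
  refine ⟨-C, fun u hu h hh => ?_⟩
  obtain ⟨hint, htru⟩ := htr u hu h hh
  have h1 := hC u hu hint
  have h2 := hF u hu.1.1 h hh
  have h3 := mul_le_mul_of_nonneg_left htru hθ.le
  have hph : 0 ≤ p h := apply_nonneg p h
  rw [kEnergy]
  nlinarith [mul_le_mul_of_nonneg_left h2 (sub_nonneg.mpr hθK1),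
    mul_le_mul_of_nonneg_right hθK hph]

end LabelledPolytope

end UniformKStability

end

theorem propositionp {m : ℕ} (P : UniformKStability.LabelledPolytope m)
    (S : Set C(P.Δ, ℝ)) (hS : P.IsSlice S) (hS' : P.IsStable S)
    (p : Seminorm ℝ C(P.Δ, ℝ)) (hp : P.IsTamed S p) (lam : ℝ) (hlam : 0 < lam) :
    (∀ f ∈ P.convexFun, ∀ πf, P.IsNormalization S f πf → lam * p πf ≤ P.futaki f) ↔
      ∀ δ : ℝ, 0 ≤ δ → δ < lam → ∃ Cδ : ℝ, ∀ u ∈ P.symplecticPotentials,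
        ∀ πu, P.IsNormalization S u πu → δ * p πu + Cδ ≤ P.kEnergy u :=
  ⟨fun hF _ hδ0 hδ => P.kEnergy_bound_of_futaki_bound hS p hp hF hδ0 hδ,
    P.futaki_bound_of_kEnergy_bound hS hS' p hp hlam⟩
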